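/- Let $K=\mathbb{F}_q$ be a finite field, $n\ge 1$, $s=n+1$, and let $A_1,\ldots,A_n\subset K$ be subsets with $d_i=|A_i|$ and $2\le d_1\le\cdots\le d_n$. Let $\mathbb{X}=[A_1\times\cdots\times A_n\times\{1\}]\subset\mathbb{P}^{n}$, let $S=K[t_1,\ldots,t_s]=\bigoplus_{d\ge 0}S_d$ with the standard grading, and let $I=I(\mathbb{X})\subset S$ be the ideal generated by the homogeneous polynomials vanishing at all points of $\mathbb{X}$. Let $\prec$ be a monomial order on $S$ with $t_i\succ t_s$ for $i=1,\ldots,n$ (for instance, a graded monomial order with $t_1\succ\cdots\succ t_s$). For a graded ideal $J\subset S$ put $H_J(e)=\dim_K(S_e/(J\cap S_e))$, let $k$ be the Krull dimension of $S/J$, and let $\deg(S/J)=(k-1)!\,\lim_{e\to\infty}H_J(e)/e^{k-1}$ if $k\ge 1$, and $\deg(S/J)=\dim_K(S/J)$ if $k=0$. Let $\mathrm{in}_\prec(I)$ be the initial ideal of $I$ and, for $d,r\ge 1$, let $\mathcal{M}_{\prec,d,r}$ be the set of all sets $M$ of $r$ distinct monomials of degree $d$ not in $\mathrm{in}_\prec(I)$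 such that $(\mathrm{in}_\prec(I):(M))\ne \mathrm{in}_\prec(I)$. The generalized footprint function of $I$ is $$\mathrm{fp}_I(d,r)=\deg(S/I)-\max\{\deg(S/(\mathrm{in}_\prec(I),M))\mid M\in\mathcal{M}_{\prec,d,r}\}\ \text{ if } \mathcal{M}_{\prec,d,r}\ne\emptyset,\qquad \mathrm{fp}_I(d,r)=\deg(S/I)\ \text{ otherwise.}$$ Let $C_{\mathbb{X}}(d)\subset K^{|\mathbb{X}|}$ be the image of $S_d$ under evaluation at the points of $\mathbb{X}$, each represented with last entry $1$, and let $\delta_{\mathbb{X}}(d,2)$ be its second generalized Hamming weight: the smallest size of the support (the set of nonzero positions) of a $2$-dimensional linear subspace of $C_{\mathbb{X}}(d)$. Let $\mathcal{P}_d$ be the set of all pairs $(a,b)$ of vectors $a=(a_1,\ldots,a_s)$, $b=(b_1,\ldots,b_s)$ in $\mathbb{N}^s$ such that $a\ne b$, $\sum_{i=1}^s a_i=\sum_{i=1}^s b_i=d$, $0\le a_i,b_i\le d_i-1$ for $i=1,\ldots,n$, and $a_i\ne 0$ and $b_j\ne 0$ for some $1\le i,j\le n$. Set $$P(a,b)=\prod_{i=1}^n(d_i-a_i)+\prod_{i=1}^n(d_i-b_i)-\prod_{i=1}^n\min\{d_i-a_i,d_i-b_i\}.$$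 Then for every integer $d$ with $1\le d\le\sum_{i=1}^n(d_i-1)$ one has $\mathrm{fp}_{I(\mathbb{X})}(d,2)=\delta_{\mathbb{X}}(d,2)$, and if moreover $(n,d)\ne(1,1)$, then $\mathcal{P}_d\neq\emptyset$ and $$\mathrm{fp}_{I(\mathbb{X})}(d,2)=\delta_{\mathbb{X}}(d,2)=\min\{P(a,b)\mid (a,b)\in\mathcal{P}_d\}.$$ -/

import Mathlib

open MvPolynomial

noncomputable section

namespace RMType

/-! ### Hilbert function and degree of a graded quotient `S/I`, `S = K[t_i : i ∈ σ]` -/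

/-- The Hilbert function `H_I(e) = dim_K (S_e / I_e)`, where `I_e = I ∩ S_e`. -/
def hilbertFunction {σ K : Type*} [Field K] (I : Ideal (MvPolynomial σ K)) (e : ℕ) : ℕ :=
  Module.finrank K
    ((homogeneousSubmodule σ K e) ⧸
      (I.restrictScalars K).submoduleOf (homogeneousSubmodule σ K e))

/-- The Krull dimension of `S/I` as a natural number (`0` for the zero ring). -/
def krullDim {σ K : Type*} [Field K] (I : Ideal (MvPolynomial σ K)) : ℕ :=
  ((ringKrullDim (MvPolynomial σ K ⧸ I)).unbotD 0).toNat

/-- The degree (multiplicity) of `S/I`: with `k` the Krull dimension of `S/I`, it is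
`(k-1)! * lim H_I(e) / e^(k-1)` when `k ≥ 1`, and `dim_K (S/I)` when `k = 0`. -/
def degree {σ K : Type*} [Field K] (I : Ideal (MvPolynomial σ K)) : ℝ :=
  if krullDim I = 0 then (Module.finrank K (MvPolynomial σ K ⧸ I) : ℝ)
  else ((krullDim I - 1).factorial : ℝ) *
    Filter.limUnder Filter.atTop
      (fun e : ℕ => (hilbertFunction I e : ℝ) / (e : ℝ) ^ (krullDim I - 1))

/-! ### Initial ideal, footprint and the generalized footprint function -/

/-- The initial ideal, generated by the leading monomials of the nonzero elements of `I`. -/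
def initialIdeal {σ K : Type*} [Field K] (m : MonomialOrder σ)
    (I : Ideal (MvPolynomial σ K)) : Ideal (MvPolynomial σ K) :=
  Ideal.span {g | ∃ f ∈ I, f ≠ 0 ∧ g = monomial (m.degree f) 1}

/-- The exponent vectors of the standard monomials of `S/I`. -/
def footprint {σ K : Type*} [Field K] (m : MonomialOrder σ)
    (I : Ideal (MvPolynomial σ K)) : Set (σ →₀ ℕ) :=
  {a | monomial a (1 : K) ∉ initialIdeal m I}

/-- The monomials with exponent vectors in `M`. -/
def monomials {σ : Type*} (K : Type*) [Field K] (M : Finset (σ →₀ ℕ)) :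
    Set (MvPolynomial σ K) :=
  (fun a => monomial a (1 : K)) '' (M : Set (σ →₀ ℕ))

/-- The sets `M` of `r` distinct standard monomials of degree `d` (given by their exponent
vectors) such that `(in(I) : (M)) ≠ in(I)`. -/
def footprintSets {σ K : Type*} [Field K] (m : MonomialOrder σ)
    (I : Ideal (MvPolynomial σ K)) (d r : ℕ) : Set (Finset (σ →₀ ℕ)) :=
  {M | M.card = r ∧ (∀ a ∈ M, a ∈ footprint m I ∧ a.degree = d) ∧
    (initialIdeal m I).colon (monomials K M) ≠ initialIdeal m I}

open Classical in
/-- The generalized footprint function `fp_I(d, r)`. -/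
def fp {σ K : Type*} [Field K] (m : MonomialOrder σ)
    (I : Ideal (MvPolynomial σ K)) (d r : ℕ) : ℝ :=
  if (footprintSets m I d r).Nonempty then
    degree I - sSup ((fun M => degree (initialIdeal m I ⊔ Ideal.span (monomials K M))) ''
      footprintSets m I d r)
  else degree I

/-! ### Generalized Hamming weights -/

/-- The support of a linear code: the set of its nonzero positions. -/
def support {ι K : Type*} [Field K] (D : Submodule K (ι → K)) : Set ι :=
  {i | ∃ v ∈ D, v i ≠ 0}

/-- The `r`-th generalized Hamming weight of the linear code `C`: the smallest size of the
support of an `r`-dimensional subcode. -/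
def generalizedHammingWeight {ι K : Type*} [Field K] (C : Submodule K (ι → K)) (r : ℕ) : ℕ :=
  sInf {w | ∃ D : Submodule K (ι → K), D ≤ C ∧ Module.finrank K D = r ∧ w = (support D).ncard}

/-! ### Projective point sets, vanishing ideals and Reed-Muller-type codes

The coordinates of `ℙ^n` are indexed by `Fin (n + 1)`: the variables `t_1, …, t_n` are indexed
by `Fin.castSucc i` for `i : Fin n`, and `t_s = t_{n+1}` by `Fin.last n`. -/

/-- The ideal generated by the homogeneous polynomials vanishing at all points of `X` (at every
vector of homogeneous coordinates of each point). -/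
def vanishingIdeal {n : ℕ} {K : Type*} [Field K] (X : Set (Projectivization K (Fin (n + 1) → K))) :
    Ideal (MvPolynomial (Fin (n + 1)) K) :=
  Ideal.span {f | (∃ e : ℕ, f.IsHomogeneous e) ∧
    ∀ (v : Fin (n + 1) → K) (hv : v ≠ 0), Projectivization.mk K v hv ∈ X → eval v f = 0}

/-- The representative with last entry `1` of a projective point (whose last homogeneous
coordinate is nonzero). -/
def normalizedRep {n : ℕ} {K : Type*} [Field K] (P : Projectivization K (Fin (n + 1) → K)) : Fin (n + 1) → K :=
  (P.rep (Fin.last n))⁻¹ • P.rep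

/-- Evaluation of polynomials at the points of `X`, represented with last entry `1`. -/
def evalMap {n : ℕ} {K : Type*} [Field K] (X : Set (Projectivization K (Fin (n + 1) → K))) :
    MvPolynomial (Fin (n + 1)) K →ₗ[K] (X → K) :=
  LinearMap.pi fun P => (aeval (normalizedRep (P : Projectivization K (Fin (n + 1) → K)))).toLinearMap

/-- The Reed-Muller-type code `C_X(d)`: the image of `S_d` under the evaluation map, for a set
`X` of points whose last homogeneous coordinate is nonzero. -/
def code {n : ℕ} {K : Type*} [Field K] (X : Set (Projectivization K (Fin (n + 1) → K))) (d : ℕ) :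
    Submodule K (X → K) :=
  (homogeneousSubmodule (Fin (n + 1)) K d).map (evalMap X)

/-- The projective cartesian set `[A_1 × ⋯ × A_n × {1}]`. -/
def cartesianSet {n : ℕ} {K : Type*} [Field K] (A : Fin n → Finset K) :
    Set (Projectivization K (Fin (n + 1) → K)) :=
  {P | ∃ (v : Fin (n + 1) → K) (hv : v ≠ 0), (∀ i : Fin n, v i.castSucc ∈ A i) ∧
    v (Fin.last n) = 1 ∧ P = Projectivization.mk K v hv}

/-! ### The combinatorial side -/

/-- The admissible pairs of exponent vectors of degree `d`. -/
def admissiblePairs {n : ℕ} (δ : Fin n → ℕ) (d : ℕ) :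
    Set ((Fin (n + 1) → ℕ) × (Fin (n + 1) → ℕ)) :=
  {p | p.1 ≠ p.2 ∧ ∑ j, p.1 j = d ∧ ∑ j, p.2 j = d ∧
    (∀ i : Fin n, p.1 i.castSucc ≤ δ i - 1 ∧ p.2 i.castSucc ≤ δ i - 1) ∧
    (∃ i : Fin n, p.1 i.castSucc ≠ 0) ∧ (∃ j : Fin n, p.2 j.castSucc ≠ 0)}

/-- `P(a, b) = ∏ (d_i - a_i) + ∏ (d_i - b_i) - ∏ min (d_i - a_i, d_i - b_i)`. -/
def pairValue {n : ℕ} (δ : Fin n → ℕ) (a b : Fin (n + 1) → ℕ) : ℤ :=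
  ∏ i : Fin n, ((δ i : ℤ) - a i.castSucc) + ∏ i : Fin n, ((δ i : ℤ) - b i.castSucc)
    - ∏ i : Fin n, min ((δ i : ℤ) - a i.castSucc) ((δ i : ℤ) - b i.castSucc)

end RMType

end

/-! Both invariants are minima of one count. For exponent vectors `a`, `b` in the box `∏ [0, d_i)`,
let `U(a, b)` (`upperCount`) be the number of box vectors above `a` or above `b`; by
inclusion-exclusion it equals `P(a, b)`.

Footprint side. The forms `∏_{γ ∈ A_i} (t_i - γ t_s)` lie in `I` and have leading monomials
`t_i^{d_i}`, because `t_i ≻ t_s`. A reduced element of `I` is zero, since its homogeneous components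
dehomogenize to polynomials of degree below `d_i` in each variable that vanish on the whole grid.
Hence `in(I) = (t_1^{d_1}, …, t_n^{d_n})` (`initialIdeal_vanishingIdeal`). In large degree the
monomials outside `in(I) + (t^a, t^b)` correspond to the box vectors above neither `a` nor `b`, so
the degree is `∏ d_i - U(a, b)` (`degree_boxIdeal`). The colon condition says that neither monomial
is a power of `t_s` (`colon_boxIdeal_ne_iff`), which gives exactly the pairs in `P_d`.

Code side, with degLex in the affine variables whatever the given order is. Products of linear
factors realize each `U(a, b)` as a support size (`exists_subcode`). Conversely, a plane contains
evaluations of reduced `f`, `g` with distinct leading exponents `a`, `b`. Monomial multiples of `f`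
and `g` realize every box vector above `a` or `b` as a leading exponent. By the Combinatorial
Nullstellensatz their evaluations are independent, and they live on the support of the plane, which
therefore has at least `U(a, b)` points (`upperCount_le_ncard_support`).

The code side also allows `a = 0` or `b = 0`, but then `U = ∏ d_i` is the largest possible value.
Such pairs matter only when `P_d` is empty, and then both invariants equal `∏ d_i`. -/

noncomputable section

namespace RMType

/-! ### Homogenization and dehomogenization with respect to the last variable -/

/-- The exponents of the variables other than the last one. -/
def truncExp {n : ℕ} (c : Fin (n + 1) →₀ ℕ) : Fin n →₀ ℕ :=
  Finsupp.equivFunOnFinite.symm fun i => c i.castSucc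

/-- The exponent vector of degree `e` extending a given one of degree at most `e`. -/
def homogExp {n : ℕ} (e : ℕ) (c : Fin n →₀ ℕ) : Fin (n + 1) →₀ ℕ :=
  Finsupp.equivFunOnFinite.symm
    (Fin.snoc (α := fun _ => ℕ) (fun i => c i) (e - c.degree))

@[simp]
lemma truncExp_apply {n : ℕ} (c : Fin (n + 1) →₀ ℕ) (i : Fin n) :
    truncExp c i = c i.castSucc := rfl

@[simp]
lemma homogExp_castSucc {n : ℕ} (e : ℕ) (c : Fin n →₀ ℕ) (i : Fin n) :
    homogExp e c i.castSucc = c i := by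
  simp [homogExp]

@[simp]
lemma homogExp_last {n : ℕ} (e : ℕ) (c : Fin n →₀ ℕ) :
    homogExp e c (Fin.last n) = e - c.degree := by
  simp [homogExp]

lemma degree_eq_truncExp_add {n : ℕ} (c : Fin (n + 1) →₀ ℕ) :
    c.degree = (truncExp c).degree + c (Fin.last n) := by
  simp [Finsupp.degree_eq_sum, Fin.sum_univ_castSucc]

lemma degree_truncExp_le {n : ℕ} (c : Fin (n + 1) →₀ ℕ) : (truncExp c).degree ≤ c.degree := by
  rw [degree_eq_truncExp_add c]; exact Nat.le_add_right _ _

@[simp]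
lemma truncExp_homogExp {n : ℕ} (e : ℕ) (c : Fin n →₀ ℕ) : truncExp (homogExp e c) = c := by
  ext i; simp

lemma degree_homogExp {n : ℕ} {e : ℕ} {c : Fin n →₀ ℕ} (h : c.degree ≤ e) :
    (homogExp e c).degree = e := by
  rw [degree_eq_truncExp_add, truncExp_homogExp, homogExp_last]; omega

lemma homogExp_truncExp {n : ℕ} (c : Fin (n + 1) →₀ ℕ) :
    homogExp c.degree (truncExp c) = c := by
  ext i
  refine Fin.lastCases ?_ (fun i => ?_) i
  · rw [homogExp_last, degree_eq_truncExp_add c]; omega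
  · simp

/-- Dehomogenization: the last variable is set to `1`. -/
def dehom (n : ℕ) (K : Type*) [Field K] :
    MvPolynomial (Fin (n + 1)) K →ₐ[K] MvPolynomial (Fin n) K :=
  aeval (Fin.snoc (α := fun _ => MvPolynomial (Fin n) K) X 1)

/-- Homogenization in degree `e` with respect to a new last variable. -/
def homog {n : ℕ} {K : Type*} [Field K] (e : ℕ) (p : MvPolynomial (Fin n) K) :
    MvPolynomial (Fin (n + 1)) K :=
  ∑ c ∈ p.support, monomial (homogExp e c) (coeff c p)

section

variable {n : ℕ} {K : Type*} [Field K]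

lemma dehom_monomial (c : Fin (n + 1) →₀ ℕ) (k : K) :
    dehom n K (monomial c k) = monomial (truncExp c) k := by
  rw [dehom, aeval_monomial, monomial_eq, Finsupp.prod_fintype _ _ (by simp),
    Finsupp.prod_fintype _ _ (by simp), Fin.prod_univ_castSucc]
  simp [algebraMap_eq]

lemma dehom_eq_sum (f : MvPolynomial (Fin (n + 1)) K) :
    dehom n K f = ∑ c ∈ f.support, monomial (truncExp c) (coeff c f) := by
  conv_lhs => rw [f.as_sum]
  simp only [map_sum, dehom_monomial]

lemma exists_of_mem_support_dehom {f : MvPolynomial (Fin (n + 1)) K} {b : Fin n →₀ ℕ}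
    (hb : b ∈ (dehom n K f).support) : ∃ c ∈ f.support, truncExp c = b := by
  classical
  by_contra! h
  rw [mem_support_iff, dehom_eq_sum, coeff_sum] at hb
  exact hb (Finset.sum_eq_zero fun c hc => by rw [coeff_monomial, if_neg (h c hc)])

/-- Among exponents of one fixed degree the truncation determines the last entry, so no two terms of
a homogeneous polynomial collide under dehomogenization. -/
lemma coeff_dehom {f : MvPolynomial (Fin (n + 1)) K} {a : Fin (n + 1) →₀ ℕ}
    (hf : f.IsHomogeneous a.degree) : coeff (truncExp a) (dehom n K f) = coeff a f := by
  classical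
  rw [dehom_eq_sum, coeff_sum, Finset.sum_eq_single a]
  · simp
  · intro c hc hca
    rw [coeff_monomial, if_neg]
    intro h
    have hd : c.degree = a.degree := by
      by_contra hne
      exact (mem_support_iff.1 hc) (hf.coeff_eq_zero hne)
    exact hca (by rw [← homogExp_truncExp c, hd, h, homogExp_truncExp])
  · intro ha
    simpa using ha

lemma eval_dehom (x : Fin n → K) (f : MvPolynomial (Fin (n + 1)) K) :
    eval x (dehom n K f) = eval (Fin.snoc (α := fun _ => K) x 1) f := by
  have : (aeval x).comp (dehom n K) = aeval (Fin.snoc (α := fun _ => K) x (1 : K)) := by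
    ext i
    refine Fin.lastCases ?_ (fun i => ?_) i <;> simp [dehom]
  simpa [aeval_eq_eval] using congrArg (fun φ => φ f) this

lemma totalDegree_dehom_le (f : MvPolynomial (Fin (n + 1)) K) :
    (dehom n K f).totalDegree ≤ f.totalDegree := by
  refine Finset.sup_le fun b hb => ?_
  obtain ⟨c, hc, rfl⟩ := exists_of_mem_support_dehom hb
  exact (degree_truncExp_le c).trans (le_totalDegree hc)

lemma isHomogeneous_homog {e : ℕ} {p : MvPolynomial (Fin n) K} (hp : p.totalDegree ≤ e) :
    (homog e p).IsHomogeneous e :=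
  IsHomogeneous.sum _ _ _ fun _ hc =>
    isHomogeneous_monomial _ (degree_homogExp ((le_totalDegree hc).trans hp))

lemma eval_homog (e : ℕ) (p : MvPolynomial (Fin n) K) (x : Fin n → K) :
    eval (Fin.snoc (α := fun _ => K) x 1) (homog e p) = eval x p := by
  rw [← eval_dehom, homog, map_sum]
  simp only [dehom_monomial, truncExp_homogExp]
  rw [← p.as_sum]

/-! ### Products of linear forms -/

/-- The product of the linear polynomials `X i - γ` for `γ ∈ B i`. -/
def linProd (B : Fin n → Finset K) : MvPolynomial (Fin n) K :=
  ∏ i, ∏ γ ∈ B i, (X i - C γ)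

lemma totalDegree_linProd_le (B : Fin n → Finset K) :
    (linProd B).totalDegree ≤ ∑ i, (B i).card := by
  refine (totalDegree_finsetProd _ _).trans (Finset.sum_le_sum fun i _ => ?_)
  refine (totalDegree_finsetProd _ _).trans ?_
  rw [Finset.card_eq_sum_ones]
  refine Finset.sum_le_sum fun γ _ => ?_
  exact (totalDegree_sub_C_le _ _).trans (totalDegree_X _).le

lemma eval_linProd_ne_zero_iff (B : Fin n → Finset K) (x : Fin n → K) :
    eval x (linProd B) ≠ 0 ↔ ∀ i, x i ∉ B i := by
  simp only [linProd, map_prod, map_sub, eval_X, eval_C, Finset.prod_ne_zero_iff,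
    Finset.mem_univ, true_implies, sub_ne_zero]
  exact forall_congr' fun i => ⟨fun h hx => h _ hx rfl, fun h γ hγ e => h (e ▸ hγ)⟩

/-! ### The points of a cartesian set -/

lemma normalizedRep_mk {v : Fin (n + 1) → K} (hv : v ≠ 0) (hl : v (Fin.last n) = 1) :
    normalizedRep (Projectivization.mk K v hv) = v := by
  obtain ⟨a, ha⟩ := Projectivization.exists_smul_eq_mk_rep K v hv
  have ha' : (a : K) ≠ 0 := a.ne_zero
  rw [normalizedRep, ← ha]
  ext j
  simp [Units.smul_def, hl, ha']

lemma snoc_one_ne_zero (x : Fin n → K) : Fin.snoc (α := fun _ => K) x 1 ≠ 0 := fun h => by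
  have := congrFun h (Fin.last n)
  simp at this

/-- The affine points of the box `∏ A i` parametrize the points of the cartesian set. -/
def boxEquiv (A : Fin n → Finset K) : Fintype.piFinset A ≃ cartesianSet A :=
  Equiv.ofBijective
    (fun x => ⟨Projectivization.mk K (Fin.snoc (α := fun _ => K) x.1 1) (snoc_one_ne_zero _),
      _, snoc_one_ne_zero _, fun i => by simpa using Fintype.mem_piFinset.1 x.2 i, by simp, rfl⟩)
    (by
      constructor
      · intro x y h
        have h1 := congrArg (fun P => normalizedRep P.1) h
        simp only at h1
        rw [normalizedRep_mk _ (by simp), normalizedRep_mk _ (by simp)] at h1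
        ext i
        simpa using congrFun h1 i.castSucc
      · rintro ⟨P, v, hv, hA, hl, rfl⟩
        refine ⟨⟨fun i => v i.castSucc, Fintype.mem_piFinset.2 hA⟩, Subtype.ext ?_⟩
        have : Fin.snoc (α := fun _ => K) (fun i : Fin n => v i.castSucc) 1 = v := by
          rw [← hl]; exact Fin.snoc_init_self v
        simp only [this])

lemma normalizedRep_boxEquiv (A : Fin n → Finset K) (x : Fintype.piFinset A) :
    normalizedRep (boxEquiv A x).1 = Fin.snoc (α := fun _ => K) x.1 1 :=
  normalizedRep_mk _ (by simp)

/-- Moves the coding problem to affine space: forms of degree `d` become polynomials of degree at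
most `d` in `n` variables on the grid. -/
lemma mem_code_iff (A : Fin n → Finset K) (d : ℕ) (v : cartesianSet A → K) :
    v ∈ code (cartesianSet A) d ↔ ∃ p : MvPolynomial (Fin n) K, p.totalDegree ≤ d ∧
      ∀ x, v (boxEquiv A x) = eval x.1 p := by
  have key : ∀ (f : MvPolynomial (Fin (n + 1)) K) (x : Fintype.piFinset A),
      evalMap (cartesianSet A) f (boxEquiv A x) = eval x.1 (dehom n K f) := by
    intro f x
    rw [eval_dehom, ← normalizedRep_boxEquiv]
    simp [evalMap, aeval_eq_eval]
  constructor
  · rintro ⟨f, hf, rfl⟩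
    exact ⟨dehom n K f, (totalDegree_dehom_le f).trans
      ((mem_homogeneousSubmodule _ _).1 hf).totalDegree_le, key f⟩
  · rintro ⟨p, hp, hv⟩
    refine ⟨homog d p, isHomogeneous_homog hp, ?_⟩
    ext P
    obtain ⟨x, rfl⟩ := (boxEquiv A).surjective P
    rw [hv, key, eval_dehom, eval_homog]

end

/-! ### The second generalized Hamming weight of a cartesian code -/

/-- The exponent vectors `c` with `c i < δ i` for all `i`. -/
def expBox {n : ℕ} (δ : Fin n → ℕ) : Finset (Fin n → ℕ) :=
  Fintype.piFinset fun i => Finset.range (δ i)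

open Classical in
/-- The number of exponent vectors in the box that are above `a` or above `b`. -/
def upperCount {n : ℕ} (δ : Fin n → ℕ) (a b : Fin n → ℕ) : ℕ :=
  ((expBox δ).filter fun c => a ≤ c ∨ b ≤ c).card

/-- The pairs of distinct exponent vectors in the box of degree at most `d`. -/
def boxPairs {n : ℕ} (δ : Fin n → ℕ) (d : ℕ) : Set ((Fin n → ℕ) × (Fin n → ℕ)) :=
  {p | p.1 ≠ p.2 ∧ p.1 ∈ expBox δ ∧ p.2 ∈ expBox δ ∧ ∑ i, p.1 i ≤ d ∧ ∑ i, p.2 i ≤ d}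

lemma mem_expBox {n : ℕ} {δ : Fin n → ℕ} {c : Fin n → ℕ} : c ∈ expBox δ ↔ ∀ i, c i < δ i := by
  simp [expBox]

section

variable {n : ℕ} {K : Type*} [Field K]

/-- Numbering each `A i` identifies grid points with exponent vectors in the box. -/
lemma exists_enumeration {α : Type*} (S : Finset α) :
    ∃ f : α → ℕ, Set.BijOn f S (Finset.range S.card) := by
  classical
  refine ⟨fun x => if h : x ∈ S then S.equivFin ⟨x, h⟩ else 0, ?_, ?_, ?_⟩
  · intro x hx
    have hx' : x ∈ S := hx
    simp [hx']
  · intro x hx y hy h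
    have hx' : x ∈ S := hx
    have hy' : y ∈ S := hy
    simp only [hx', hy', dif_pos] at h
    exact congrArg Subtype.val (S.equivFin.injective (Fin.ext h))
  · intro k hk
    have hk' : k < S.card := by simpa using hk
    refine ⟨S.equivFin.symm ⟨k, hk'⟩, Finset.coe_mem _, ?_⟩
    simp

lemma support_span_pair {ι : Type*} (v w : ι → K) :
    support (Submodule.span K {v, w}) = {i | v i ≠ 0 ∨ w i ≠ 0} := by
  ext i
  constructor
  · rintro ⟨u, hu, hi⟩
    obtain ⟨s, t, rfl⟩ := Submodule.mem_span_pair.1 hu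
    by_contra h
    simp only [Set.mem_ofPred_eq, not_or, not_not] at h
    exact hi (by simp [h.1, h.2])
  · rintro (h | h)
    · exact ⟨v, Submodule.subset_span (by simp), h⟩
    · exact ⟨w, Submodule.subset_span (by simp), h⟩

/-- Distinct exponent vectors give a plane in the code whose support is the union of two boxes. -/
lemma exists_subcode (A : Fin n → Finset K) {d : ℕ} {p : (Fin n → ℕ) × (Fin n → ℕ)}
    (hp : p ∈ boxPairs (fun i => (A i).card) d) :
    ∃ D : Submodule K (cartesianSet A → K), D ≤ code (cartesianSet A) d ∧
      Module.finrank K D = 2 ∧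
      upperCount (fun i => (A i).card) p.1 p.2 = (support D).ncard := by
  classical
  obtain ⟨a, b⟩ := p
  obtain ⟨hab, ha, hb, had, hbd⟩ := hp
  simp only at hab ha hb had hbd ⊢
  choose idx hidx using fun i => exists_enumeration (A i)
  let F : cartesianSet A → Fin n → ℕ := fun P i => idx i (((boxEquiv A).symm P).1 i)
  have hmem : ∀ (P : cartesianSet A) i, ((boxEquiv A).symm P).1 i ∈ A i := fun P i =>
    Fintype.mem_piFinset.1 ((boxEquiv A).symm P).2 i
  have hF : Function.Injective F := fun P Q h => by
    refine (boxEquiv A).symm.injective (Subtype.ext (funext fun i => ?_))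
    exact (hidx i).injOn (hmem P i) (hmem Q i) (congrFun h i)
  have hFr : ∀ c ∈ expBox (fun i => (A i).card), ∃ P, F P = c := fun c hc => by
    have : ∀ i, ∃ x ∈ A i, idx i x = c i := fun i => by
      obtain ⟨x, hx, h⟩ := (hidx i).surjOn
        (show c i ∈ (Finset.range (A i).card : Set ℕ) by simpa using mem_expBox.1 hc i)
      exact ⟨x, hx, h⟩
    choose x hx h using this
    refine ⟨boxEquiv A ⟨x, Fintype.mem_piFinset.2 hx⟩, ?_⟩
    ext i
    simp [F, h]
  have hFb : ∀ P, F P ∈ expBox (fun i => (A i).card) := fun P => mem_expBox.2 fun i => by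
    simpa using (hidx i).mapsTo (hmem P i)
  -- The factors kill the first `c i` elements of `A i`, so `v c` is nonzero exactly at the points
  -- whose index vector is above `c`.
  let B : (Fin n → ℕ) → Fin n → Finset K := fun c i => (A i).filter fun γ => idx i γ < c i
  have hB : ∀ c i, (B c i).card ≤ c i := fun c i => by
    rw [← Finset.card_range (c i)]
    refine Finset.card_le_card_of_injOn (idx i) (fun γ hγ => ?_) ((hidx i).injOn.mono ?_)
    · simpa using (Finset.mem_filter.1 hγ).2
    · exact Finset.coe_subset.2 (Finset.filter_subset _ _)
  let v : (Fin n → ℕ) → cartesianSet A → K := fun c P =>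
    eval ((boxEquiv A).symm P).1 (linProd (B c))
  have hv : ∀ c P, v c P ≠ 0 ↔ c ≤ F P := fun c P => by
    rw [eval_linProd_ne_zero_iff, Pi.le_def]
    refine forall_congr' fun i => ?_
    simp [B, F, hmem P i]
  have hvd : ∀ c : Fin n → ℕ, ∑ i, c i ≤ d → v c ∈ code (cartesianSet A) d := fun c hc =>
    (mem_code_iff A d _).2 ⟨linProd (B c), (totalDegree_linProd_le _).trans
      ((Finset.sum_le_sum fun i _ => hB c i).trans hc), fun x => by simp [v]⟩
  -- Evaluate at the point with index vector `c`: there `v c` is nonzero, while `v e` vanishes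
  -- because `e` is not below `c`.
  have hind : ∀ c e : Fin n → ℕ, c ∈ expBox (fun i => (A i).card) → ¬ e ≤ c →
      ∀ s t : K, s • v c + t • v e = 0 → s = 0 := fun c e hc hec s t h => by
    obtain ⟨P, rfl⟩ := hFr c hc
    have h1 := congrFun h P
    have h2 : v e P = 0 := not_not.1 fun h' => hec ((hv e P).1 h')
    simpa [h2, (hv (F P) P).2 le_rfl] using h1
  have hne : ∀ c ∈ expBox (fun i => (A i).card), ∀ t : K, t • v c = 0 → t = 0 :=
    fun c hc t h => by
      obtain ⟨P, rfl⟩ := hFr c hc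
      have h1 := congrFun h P
      simpa [(hv (F P) P).2 le_rfl] using h1
  have hli : LinearIndependent K ![v a, v b] := by
    rw [LinearIndependent.pair_iff]
    intro s t h
    by_cases hba : b ≤ a
    · have h' : ¬ a ≤ b := fun h' => hab (le_antisymm h' hba)
      have ht := hind b a hb h' t s ((add_comm _ _).trans h)
      subst ht
      exact ⟨hne a ha s (by simpa using h), rfl⟩
    · have hs := hind a b ha hba s t h
      subst hs
      exact ⟨rfl, hne b hb t (by simpa using h)⟩
  refine ⟨Submodule.span K {v a, v b}, ?_, ?_, ?_⟩
  · rw [Submodule.span_le]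
    rintro _ (rfl | rfl)
    · exact hvd a had
    · exact hvd b hbd
  · have hr : ({v a, v b} : Set (cartesianSet A → K)) = Set.range ![v a, v b] :=
      (Matrix.range_cons_cons_empty _ _ _).symm
    rw [hr, finrank_span_eq_card hli, Fintype.card_fin]
  · rw [support_span_pair, upperCount, ← Set.ncard_coe_finset]
    rw [← Set.ncard_preimage_of_injective_subset_range hF]
    · congr 1
      ext P
      simp [hv, hFb P]
    · intro c hc
      exact hFr c (Finset.mem_filter.1 hc).1

/-- Every polynomial agrees on the box `∏ A i` with a reduced one of no larger degree. -/
lemma exists_reduced (A : Fin n → Finset K) (p : MvPolynomial (Fin n) K) :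
    ∃ r : MvPolynomial (Fin n) K, (∀ x ∈ Fintype.piFinset A, eval x r = eval x p) ∧
      r.totalDegree ≤ p.totalDegree ∧
      ∀ c ∈ r.support, ⇑c ∈ expBox fun i => (A i).card := by
  let b : Fin n → MvPolynomial (Fin n) K := fun i => ∏ γ ∈ A i, (X i - C γ)
  have hb : ∀ i, MonomialOrder.degLex.Monic (b i) := fun i =>
    MonomialOrder.Monic.prod fun γ _ => MonomialOrder.monic_X_sub_C _ i γ
  have hbd : ∀ i, MonomialOrder.degLex.degree (b i) = Finsupp.single i (A i).card := fun i => by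
    rw [MonomialOrder.degree_prod_of_regular]
    · simp [MonomialOrder.degree_X_sub_C]
    · intro γ _
      rw [MonomialOrder.monic_X_sub_C]
      exact isRegular_one
  obtain ⟨g, r, hf, hg, hr⟩ := MonomialOrder.degLex.div (b := b)
    (fun i => by simp [(hb i).leadingCoeff_eq_one]) p
  rw [Finsupp.linearCombination_apply, Finsupp.sum] at hf
  refine ⟨r, fun x hx => ?_, ?_, fun c hc => mem_expBox.2 fun i => ?_⟩
  · rw [hf, map_add, map_sum, Finset.sum_eq_zero, zero_add]
    intro i _
    have : eval x (b i) = 0 := by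
      simp only [b, map_prod]
      exact Finset.prod_eq_zero (Fintype.mem_piFinset.1 hx i) (by simp)
    simp [this]
  · rw [← sub_eq_iff_eq_add'] at hf
    rw [← hf]
    refine (totalDegree_sub _ _).trans (max_le le_rfl ?_)
    refine totalDegree_finsetSum_le fun i _ => ?_
    rw [smul_eq_mul, mul_comm]
    -- A degree-compatible order is needed here: division then never raises the total degree.
    exact degLex_totalDegree_monotone (hg i)
  · have := hr c hc i
    rw [hbd, Finsupp.single_le_iff] at this
    exact not_le.1 this

/-- A plane in the code contains the evaluations of two polynomials with distinct reduced
leading exponents. -/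
lemma exists_leading_ne (A : Fin n → Finset K) {d : ℕ} {D : Submodule K (cartesianSet A → K)}
    (hD : D ≤ code (cartesianSet A) d) (h2 : Module.finrank K D = 2) :
    ∃ f g : MvPolynomial (Fin n) K, f ≠ 0 ∧ g ≠ 0 ∧
      MonomialOrder.degLex.degree f ≠ MonomialOrder.degLex.degree g ∧
      (f.totalDegree ≤ d ∧ g.totalDegree ≤ d) ∧
      (∀ c ∈ f.support, ⇑c ∈ expBox fun i => (A i).card) ∧
      (∀ c ∈ g.support, ⇑c ∈ expBox fun i => (A i).card) ∧
      (fun P => eval ((boxEquiv A).symm P).1 f) ∈ D ∧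
      (fun P => eval ((boxEquiv A).symm P).1 g) ∈ D := by
  have hred : ∀ v ∈ D, ∃ r : MvPolynomial (Fin n) K, r.totalDegree ≤ d ∧
      (∀ c ∈ r.support, ⇑c ∈ expBox fun i => (A i).card) ∧
      (fun P => eval ((boxEquiv A).symm P).1 r) = v := by
    intro v hv
    obtain ⟨p, hp, hpv⟩ := (mem_code_iff A d v).1 (hD hv)
    obtain ⟨r, hr, hrd, hrs⟩ := exists_reduced A p
    refine ⟨r, hrd.trans hp, hrs, funext fun P => ?_⟩
    rw [hr _ ((boxEquiv A).symm P).2, ← hpv, Equiv.apply_symm_apply]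
  have : FiniteDimensional K D := Module.finite_of_finrank_eq_succ h2
  let B := Module.finBasisOfFinrankEq K D h2
  have hli : LinearIndependent K ![(B 0 : cartesianSet A → K), B 1] := by
    have h := B.linearIndependent.map' D.subtype (Submodule.ker_subtype D)
    have he : (![(B 0 : cartesianSet A → K), B 1] : Fin 2 → _) = D.subtype ∘ B := by
      ext i
      fin_cases i <;> rfl
    rw [he]
    exact h
  obtain ⟨f, hfd, hfs, hfv⟩ := hred _ (B 0).2
  obtain ⟨g, hgd, hgs, hgv⟩ := hred _ (B 1).2
  rw [← hfv, ← hgv, LinearIndependent.pair_iff] at hli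
  have hf0 : f ≠ 0 := by
    rintro rfl
    have := (hli 1 0 (by ext; simp)).1
    exact one_ne_zero this
  have hg0 : g ≠ 0 := by
    rintro rfl
    have := (hli 0 1 (by ext; simp)).2
    exact one_ne_zero this
  have hfD : (fun P => eval ((boxEquiv A).symm P).1 f) ∈ D := hfv ▸ (B 0).2
  have hgD : (fun P => eval ((boxEquiv A).symm P).1 g) ∈ D := hgv ▸ (B 1).2
  by_cases hne : MonomialOrder.degLex.degree f = MonomialOrder.degLex.degree g
  swap
  · exact ⟨f, g, hf0, hg0, hne, ⟨hfd, hgd⟩, hfs, hgs, hfD, hgD⟩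
  -- With equal leading exponents, `s • g - t • f` cancels the common leading term, so its own
  -- leading exponent is different.
  set s := MonomialOrder.degLex.leadingCoeff f with hs
  set t := MonomialOrder.degLex.leadingCoeff g with ht
  have hs0 : s ≠ 0 := MonomialOrder.leadingCoeff_ne_zero_iff.2 hf0
  have hev : (fun P => eval ((boxEquiv A).symm P).1 (s • g - t • f)) =
      s • (fun P => eval ((boxEquiv A).symm P).1 g) -
        t • (fun P : cartesianSet A => eval ((boxEquiv A).symm P).1 f) := by
    ext P; simp [smul_eval]
  have h0 : s • g - t • f ≠ 0 := by
    intro h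
    rw [h] at hev
    refine hs0 (hli (-t) s ?_).2
    rw [neg_smul, neg_add_eq_sub, ← hev]
    ext; simp
  refine ⟨f, s • g - t • f, hf0, h0, ?_, ⟨hfd, ?_⟩, hfs, ?_, hfD, ?_⟩
  · intro h
    apply MonomialOrder.degLex.coeff_degree_ne_zero_iff.2 h0
    rw [← h, coeff_sub, coeff_smul, coeff_smul]
    conv_lhs => enter [1]; rw [hne]
    change s * t - t * s = 0
    ring
  · exact (totalDegree_sub _ _).trans (max_le ((totalDegree_smul_le _ _).trans hgd)
      ((totalDegree_smul_le _ _).trans hfd))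
  · classical
    intro c hc
    rcases Finset.mem_union.1 (support_sub _ _ _ hc) with h | h
    · exact hgs c (support_smul h)
    · exact hfs c (support_smul h)
  · rw [hev]
    exact D.sub_mem (D.smul_mem _ hgD) (D.smul_mem _ hfD)

/-- The footprint bound for two polynomials on the box `∏ A i`. -/
lemma upperCount_le_ncard_support (A : Fin n → Finset K) {D : Submodule K (cartesianSet A → K)}
    {f g : MvPolynomial (Fin n) K} (hf : f ≠ 0) (hg : g ≠ 0)
    (hfD : (fun P => eval ((boxEquiv A).symm P).1 f) ∈ D)
    (hgD : (fun P => eval ((boxEquiv A).symm P).1 g) ∈ D) :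
    upperCount (fun i => (A i).card) (MonomialOrder.degLex.degree f)
      (MonomialOrder.degLex.degree g) ≤ (support D).ncard := by
  classical
  set a := MonomialOrder.degLex.degree f with ha
  set b := MonomialOrder.degLex.degree g with hb
  have : Finite (cartesianSet A) := Finite.of_equiv _ (boxEquiv A)
  let ι : (Fin n → ℕ) → (Fin n →₀ ℕ) := Finsupp.equivFunOnFinite.symm
  let h : (Fin n → ℕ) → MvPolynomial (Fin n) K := fun c =>
    if (a : Fin n → ℕ) ≤ c then monomial (ι c - a) 1 * f else monomial (ι c - b) 1 * g
  have hmon : ∀ (c : Fin n → ℕ) (q : MvPolynomial (Fin n) K), q ≠ 0 →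
      ⇑(MonomialOrder.degLex.degree q) ≤ c →
      monomial (ι c - MonomialOrder.degLex.degree q) 1 * q ≠ 0 ∧
      MonomialOrder.degLex.degree (monomial (ι c - MonomialOrder.degLex.degree q) 1 * q) = ι c := by
    intro c q hq hc
    have h1 : monomial (ι c - MonomialOrder.degLex.degree q) (1 : K) ≠ 0 := by simp
    refine ⟨mul_ne_zero h1 hq, ?_⟩
    rw [MonomialOrder.degree_mul h1 hq, MonomialOrder.degree_monomial, if_neg one_ne_zero]
    exact tsub_add_cancel_of_le (fun i => hc i)
  set T := (expBox fun i => (A i).card).filter fun c => (a : Fin n → ℕ) ≤ c ∨ (b : Fin n → ℕ) ≤ c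
    with hT
  have hdeg : ∀ c ∈ T, h c ≠ 0 ∧ MonomialOrder.degLex.degree (h c) = ι c := by
    intro c hc
    by_cases hac : (a : Fin n → ℕ) ≤ c
    · simpa only [h, if_pos hac] using hmon c f hf hac
    · simpa only [h, if_neg hac] using
        hmon c g hg ((Finset.mem_filter.1 hc).2.resolve_left hac)
  -- It suffices to find one independent function on the support of `D` for each element of `T`.
  have hli : LinearIndependent K fun (c : T) (P : support D) =>
      eval ((boxEquiv A).symm P.1).1 (h c) := by
    rw [Fintype.linearIndependent_iff]
    intro k hk
    by_contra! hne
    obtain ⟨c₀, hc₀, hmax⟩ := Finset.exists_max_image (Finset.univ.filter fun c : T => k c ≠ 0)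
      (fun c => MonomialOrder.degLex.toSyn (ι c)) (by
        obtain ⟨c, hc⟩ := hne
        exact ⟨c, by simpa using hc⟩)
    have hk₀ : k c₀ ≠ 0 := (Finset.mem_filter.1 hc₀).2
    set p : MvPolynomial (Fin n) K := ∑ c : T, k c • h c with hp
    have hcoeff : coeff (ι c₀) p ≠ 0 := by
      rw [hp, coeff_sum, Finset.sum_eq_single c₀]
      · rw [coeff_smul, ← (hdeg c₀ c₀.2).2]
        exact mul_ne_zero hk₀ (MonomialOrder.degLex.coeff_degree_ne_zero_iff.2 (hdeg c₀ c₀.2).1)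
      · intro c _ hcc
        by_cases hkc : k c = 0
        · simp [hkc]
        · rw [coeff_smul, MonomialOrder.coeff_eq_zero_of_lt (m := MonomialOrder.degLex), smul_zero]
          rw [(hdeg c c.2).2]
          refine lt_of_le_of_ne (hmax c (by simpa using hkc)) fun e => hcc ?_
          exact Subtype.ext (Finsupp.equivFunOnFinite.symm.injective
            (MonomialOrder.degLex.toSyn.injective e))
      · simp
    -- The degLex-largest exponent also has maximal total degree, which is what the Combinatorial
    -- Nullstellensatz requires.
    have htot : p.totalDegree = (ι c₀).degree := by
      refine le_antisymm (totalDegree_finsetSum_le fun c _ => ?_)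
        (le_totalDegree (mem_support_iff.2 hcoeff))
      by_cases hkc : k c = 0
      · simp [hkc]
      · refine (totalDegree_smul_le _ _).trans ?_
        rw [← degree_degLexDegree, (hdeg c c.2).2]
        exact Finsupp.DegLex.monotone_degree (hmax c (by simpa using hkc))
    obtain ⟨x, hx, hpx⟩ := combinatorial_nullstellensatz_exists_eval_nonzero p (ι c₀) hcoeff htot A
      (mem_expBox.1 (Finset.mem_filter.1 c₀.2).1)
    apply hpx
    let x' : Fintype.piFinset A := ⟨x, Fintype.mem_piFinset.2 hx⟩
    have hsum : eval x p = ∑ c : T, k c * eval x (h c) := by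
      simp [hp, map_sum, smul_eval]
    rw [hsum]
    by_cases hP : boxEquiv A x' ∈ support D
    · have := congrFun hk ⟨_, hP⟩
      simpa [x'] using this
    -- Off the support both `f` and `g` vanish, hence so do all their multiples; the nonzero value
    -- of `p` cannot occur there either.
    · have hz : ∀ v ∈ D, v (boxEquiv A x') = 0 := fun v hv => by
        by_contra hne'
        exact hP ⟨v, hv, hne'⟩
      have hfx : eval x f = 0 := by simpa [x'] using hz _ hfD
      have hgx : eval x g = 0 := by simpa [x'] using hz _ hgD
      refine Finset.sum_eq_zero fun c _ => ?_
      simp only [h]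
      split_ifs <;> simp [hfx, hgx]
  have := Fintype.ofFinite (support D)
  have hcard := hli.fintype_card_le_finrank
  rw [Module.finrank_fintype_fun_eq_card, Fintype.card_coe] at hcard
  rw [upperCount]
  refine hcard.trans_eq ?_
  rw [← Nat.card_eq_fintype_card, Nat.card_coe_set_eq]

/-- The second generalized Hamming weight of a cartesian code in terms of exponent vectors. -/
theorem isLeast_generalizedHammingWeight (A : Fin n → Finset K) {d : ℕ}
    (hne : (boxPairs (fun i => (A i).card) d).Nonempty) :
    IsLeast ((fun p => upperCount (fun i => (A i).card) p.1 p.2) ''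
      boxPairs (fun i => (A i).card) d)
      (generalizedHammingWeight (code (cartesianSet A) d) 2) := by
  have hup : ∀ p ∈ boxPairs (fun i => (A i).card) d,
      generalizedHammingWeight (code (cartesianSet A) d) 2 ≤
        upperCount (fun i => (A i).card) p.1 p.2 := fun p hp => Nat.sInf_le (exists_subcode A hp)
  refine ⟨?_, ?_⟩
  · obtain ⟨p, hp⟩ := hne
    -- Nonemptiness ensures that the infimum is attained and is not the default value `0`.
    obtain ⟨D, hD, h2, hw⟩ := Nat.sInf_mem (⟨_, exists_subcode A hp⟩ :
      {w | ∃ D : Submodule K (cartesianSet A → K), D ≤ code (cartesianSet A) d ∧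
        Module.finrank K D = 2 ∧ w = (support D).ncard}.Nonempty)
    obtain ⟨f, g, hf, hg, hfg, ⟨hfd, hgd⟩, hfs, hgs, hfD, hgD⟩ := exists_leading_ne A hD h2
    have hmem : (⇑(MonomialOrder.degLex.degree f), ⇑(MonomialOrder.degLex.degree g)) ∈
        boxPairs (fun i => (A i).card) d := by
      refine ⟨fun h => hfg (DFunLike.coe_injective h),
        hfs _ (MonomialOrder.degLex.degree_mem_support hf),
        hgs _ (MonomialOrder.degLex.degree_mem_support hg), ?_, ?_⟩
      · rw [← Finsupp.degree_eq_sum, degree_degLexDegree]; exact hfd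
      · rw [← Finsupp.degree_eq_sum, degree_degLexDegree]; exact hgd
    refine ⟨_, hmem, le_antisymm ?_ (hup _ hmem)⟩
    exact (upperCount_le_ncard_support A hf hg hfD hgD).trans_eq hw.symm
  · rintro _ ⟨p, hp, rfl⟩
    exact hup p hp

end

/-! ### Krull dimension and degree of one-dimensional quotients -/

section

variable {n : ℕ} {K : Type*} [Field K]

/-- Incomparability: contraction along an integral extension is strictly monotone on primes. -/
lemma ringKrullDim_le_of_isIntegral (R S : Type*) [CommRing R] [CommRing S] [Algebra R S]
    [Algebra.IsIntegral R S] : ringKrullDim S ≤ ringKrullDim R :=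
  Order.krullDim_le_of_strictMono (fun P : PrimeSpectrum S => P.comap (algebraMap R S))
    fun P Q h => by
      have h' : P.asIdeal < Q.asIdeal := h
      exact Ideal.IsIntegral.comap_lt_comap (R := R) h'

/-- If all variables are integral modulo `J` over the subring generated by the last variable, and
the quotient maps onto the polynomial ring in this variable, then its dimension is `1`. -/
lemma krullDim_eq_one (J : Ideal (MvPolynomial (Fin (n + 1)) K))
    (ψ : MvPolynomial (Fin (n + 1)) K →ₐ[K] Polynomial K)
    (hψ : ψ (X (Fin.last n)) = Polynomial.X) (hJ : ∀ f ∈ J, ψ f = 0)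
    (hint : ∀ i : Fin n, ∃ s : Multiset K,
      (s.map fun γ => X i.castSucc - C γ * X (Fin.last n)).prod ∈ J) :
    krullDim J = 1 := by
  have hdim : ringKrullDim (Polynomial K) = 1 :=
    IsPrincipalIdealRing.ringKrullDim_eq_one _ (Polynomial.not_isField K)
  have hlow : ringKrullDim (Polynomial K) ≤ ringKrullDim (MvPolynomial (Fin (n + 1)) K ⧸ J) := by
    refine ringKrullDim_le_of_surjective (Ideal.Quotient.lift J ψ.toRingHom hJ) ?_
    refine Ideal.Quotient.lift_surjective_of_surjective J hJ fun p => ?_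
    refine ⟨Polynomial.aeval (X (Fin.last n)) p, ?_⟩
    change ψ _ = p
    rw [← Polynomial.aeval_algHom_apply, hψ, Polynomial.aeval_X_left_apply]
  let φ : Polynomial K →ₐ[K] MvPolynomial (Fin (n + 1)) K ⧸ J :=
    Polynomial.aeval (Ideal.Quotient.mk J (X (Fin.last n)))
  let : Algebra (Polynomial K) (MvPolynomial (Fin (n + 1)) K ⧸ J) := φ.toRingHom.toAlgebra
  have halg : ∀ p, algebraMap (Polynomial K) (MvPolynomial (Fin (n + 1)) K ⧸ J) p = φ p :=
    fun _ => rfl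
  have hφX : φ Polynomial.X = Ideal.Quotient.mk J (X (Fin.last n)) := Polynomial.aeval_X _
  have hφC : ∀ k, φ (Polynomial.C k) = Ideal.Quotient.mk J (C k) := fun k => Polynomial.aeval_C _ k
  have hX : ∀ j, IsIntegral (Polynomial K) (Ideal.Quotient.mk J (X j)) := fun j => by
    refine Fin.lastCases ?_ (fun i => ?_) j
    · rw [← hφX, ← halg]
      exact isIntegral_algebraMap
    · obtain ⟨s, hs⟩ := hint i
      -- The product in `J` is read as a monic polynomial in the variable `X i.castSucc`, with
      -- coefficients in the subring generated by the last variable.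
      refine ⟨(s.map fun γ => Polynomial.X - Polynomial.C (Polynomial.C γ * Polynomial.X)).prod,
        Polynomial.monic_multiset_prod_of_monic _ _ fun γ _ => Polynomial.monic_X_sub_C _, ?_⟩
      rw [← Ideal.Quotient.eq_zero_iff_mem, map_multiset_prod, Multiset.map_map] at hs
      rw [← Polynomial.coe_eval₂RingHom, map_multiset_prod, Multiset.map_map, ← hs]
      congr 2
      ext γ
      simp [halg, hφX, hφC]
  have hI : Algebra.IsIntegral (Polynomial K) (MvPolynomial (Fin (n + 1)) K ⧸ J) := ⟨fun x => by
    obtain ⟨f, rfl⟩ := Ideal.Quotient.mk_surjective x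
    induction f using MvPolynomial.induction_on with
    | C k =>
      rw [← hφC, ← halg]
      exact isIntegral_algebraMap
    | add p q hp hq => rw [map_add]; exact hp.add hq
    | mul_X p j hp => rw [map_mul]; exact hp.mul (hX j)⟩
  have hup := ringKrullDim_le_of_isIntegral (Polynomial K) (MvPolynomial (Fin (n + 1)) K ⧸ J)
  rw [krullDim, le_antisymm hup hlow, hdim]
  rfl

lemma degree_eq_of_hilbertFunction_eq {σ : Type*} {J : Ideal (MvPolynomial σ K)}
    (hJ : krullDim J = 1) {N D : ℕ} (h : ∀ e, N ≤ e → hilbertFunction J e = D) :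
    degree J = D := by
  rw [degree, if_neg (by omega), hJ]
  have : Filter.Tendsto (fun e : ℕ => (hilbertFunction J e : ℝ) / (e : ℝ) ^ (1 - 1)) Filter.atTop
      (nhds (D : ℝ)) := by
    refine tendsto_const_nhds.congr' ?_
    filter_upwards [Filter.eventually_ge_atTop N] with e he
    simp [h e he]
  rw [this.limUnder_eq]
  simp

/-- Applied twice: with evaluation at the grid points for the vanishing ideal, and with coefficients
at standard monomials for the monomial ideal. -/
lemma hilbertFunction_eq_card {σ ι : Type*} [Fintype ι] {J : Ideal (MvPolynomial σ K)} {e : ℕ}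
    (φ : MvPolynomial σ K →ₗ[K] ι → K) (hsurj : ∀ v, ∃ f, f.IsHomogeneous e ∧ φ f = v)
    (hker : ∀ f, f.IsHomogeneous e → (φ f = 0 ↔ f ∈ J)) :
    hilbertFunction J e = Fintype.card ι := by
  let φ' := φ.domRestrict (homogeneousSubmodule σ K e)
  have hs : Function.Surjective φ' := fun v => by
    obtain ⟨f, hf, rfl⟩ := hsurj v
    exact ⟨⟨f, hf⟩, rfl⟩
  have hk : LinearMap.ker φ' =
      (J.restrictScalars K).submoduleOf (homogeneousSubmodule σ K e) := by
    ext ⟨f, hf⟩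
    exact hker f hf
  rw [hilbertFunction, ← hk, (φ'.quotKerEquivOfSurjective hs).finrank_eq,
    Module.finrank_fintype_fun_eq_card]

/-! ### The vanishing ideal of a cartesian set -/

lemma eval_snoc_eq_zero_of_mem {A : Fin n → Finset K} {f : MvPolynomial (Fin (n + 1)) K}
    (hf : f ∈ vanishingIdeal (cartesianSet A)) {x : Fin n → K} (hx : ∀ i, x i ∈ A i) :
    eval (Fin.snoc (α := fun _ => K) x 1) f = 0 := by
  have : vanishingIdeal (cartesianSet A) ≤
      RingHom.ker (eval (Fin.snoc (α := fun _ => K) x 1)) := by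
    refine Ideal.span_le.2 fun g hg => ?_
    exact hg.2 _ (snoc_one_ne_zero x) (boxEquiv A ⟨x, Fintype.mem_piFinset.2 hx⟩).2
  exact this hf

lemma degree_eq_of_mem_support {σ : Type*} {f : MvPolynomial σ K} {e : ℕ}
    (hf : f.IsHomogeneous e) {c : σ →₀ ℕ} (hc : c ∈ f.support) : c.degree = e := by
  by_contra hne
  exact (mem_support_iff.1 hc) (hf.coeff_eq_zero hne)

lemma eval_smul_of_isHomogeneous {σ : Type*} {f : MvPolynomial σ K} {e : ℕ}
    (hf : f.IsHomogeneous e) (k : K) (v : σ → K) : eval (k • v) f = k ^ e * eval v f := by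
  rw [eval_eq, eval_eq, Finset.mul_sum]
  refine Finset.sum_congr rfl fun c hc => ?_
  have hd : ∑ i ∈ c.support, c i = e :=  degree_eq_of_mem_support hf hc
  simp only [Pi.smul_apply, smul_eq_mul, mul_pow, Finset.prod_mul_distrib,
    Finset.prod_pow_eq_pow_sum, hd]
  ring

lemma mem_vanishingIdeal {A : Fin n → Finset K} {f : MvPolynomial (Fin (n + 1)) K} {e : ℕ}
    (hf : f.IsHomogeneous e)
    (h : ∀ x : Fin n → K, (∀ i, x i ∈ A i) → eval (Fin.snoc (α := fun _ => K) x 1) f = 0) :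
    f ∈ vanishingIdeal (cartesianSet A) := by
  refine Ideal.subset_span ⟨⟨e, hf⟩, ?_⟩
  rintro v hv ⟨w, hw, hwA, hwl, heq⟩
  obtain ⟨k, rfl⟩ := (Projectivization.mk_eq_mk_iff' K v w hv hw).1 heq
  have hw' : Fin.snoc (α := fun _ => K) (fun i : Fin n => w i.castSucc) 1 = w := by
    rw [← hwl]; exact Fin.snoc_init_self w
  rw [eval_smul_of_isHomogeneous hf, ← hw', h _ hwA, mul_zero]

lemma homogeneousComponent_mem_vanishingIdeal {X : Set (Projectivization K (Fin (n + 1) → K))}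
    {f : MvPolynomial (Fin (n + 1)) K} (hf : f ∈ vanishingIdeal X) (e : ℕ) :
    homogeneousComponent e f ∈ vanishingIdeal X := by
  let := MvPolynomial.gradedAlgebra (σ := Fin (n + 1)) (R := K)
  refine homogeneousComponent_mem_of_mem (Ideal.homogeneous_span _ _ fun g hg => ?_) hf e
  obtain ⟨⟨k, hk⟩, -⟩ := hg
  exact ⟨k, hk⟩

/-- The homogeneous polynomial of degree `#(A i)` vanishing where the `i`-th coordinate is
in `A i`. -/
def boxPoly (A : Fin n → Finset K) (i : Fin n) : MvPolynomial (Fin (n + 1)) K :=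
  ∏ γ ∈ A i, (X i.castSucc - C γ * X (Fin.last n))

lemma boxPoly_mem (A : Fin n → Finset K) (i : Fin n) :
    boxPoly A i ∈ vanishingIdeal (cartesianSet A) := by
  refine mem_vanishingIdeal (e := ∑ γ ∈ A i, 1)
    (IsHomogeneous.prod _ _ _ fun γ _ => (isHomogeneous_X _ _).sub ?_) fun x hx => ?_
  · simpa using (isHomogeneous_C (Fin (n + 1)) γ).mul (isHomogeneous_X K (Fin.last n))
  · rw [boxPoly, map_prod]
    exact Finset.prod_eq_zero (hx i) (by simp)

/-- The assumption `t_i ≻ t_s` does its work here: it makes `t_i` the leading monomial of each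
factor. -/
lemma monic_degree_factor (m : MonomialOrder (Fin (n + 1))) {i : Fin n}
    (hm : m.toSyn (Finsupp.single (Fin.last n) 1) < m.toSyn (Finsupp.single i.castSucc 1))
    (γ : K) :
    m.Monic (X i.castSucc - C γ * X (Fin.last n)) ∧
      m.degree (X i.castSucc - C γ * X (Fin.last n)) = Finsupp.single i.castSucc 1 := by
  have hlt : m.toSyn (m.degree (C γ * X (Fin.last n) : MvPolynomial (Fin (n + 1)) K)) <
      m.toSyn (m.degree (X i.castSucc : MvPolynomial (Fin (n + 1)) K)) := by
    rw [m.degree_X]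
    refine lt_of_le_of_lt ?_ hm
    rw [C_mul_X_eq_monomial]
    exact m.degree_monomial_le γ
  refine ⟨?_, ?_⟩
  · rw [MonomialOrder.Monic, m.leadingCoeff_sub_of_lt hlt, m.leadingCoeff_X]
  · rw [m.degree_sub_of_lt hlt, m.degree_X]

lemma monic_boxPoly (m : MonomialOrder (Fin (n + 1))) (A : Fin n → Finset K) {i : Fin n}
    (hm : m.toSyn (Finsupp.single (Fin.last n) 1) < m.toSyn (Finsupp.single i.castSucc 1)) :
    m.Monic (boxPoly A i) :=
  MonomialOrder.Monic.prod fun γ _ => (monic_degree_factor m hm γ).1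

lemma degree_boxPoly (m : MonomialOrder (Fin (n + 1))) (A : Fin n → Finset K) {i : Fin n}
    (hm : m.toSyn (Finsupp.single (Fin.last n) 1) < m.toSyn (Finsupp.single i.castSucc 1)) :
    m.degree (boxPoly A i) = Finsupp.single i.castSucc (A i).card := by
  rw [boxPoly, MonomialOrder.degree_prod]
  · simp [(monic_degree_factor m hm _).2]
  · exact fun γ _ => (monic_degree_factor m hm γ).1.ne_zero

/-- A reduced polynomial in the vanishing ideal is zero. -/
lemma eq_zero_of_mem_vanishingIdeal {A : Fin n → Finset K} (hA : ∀ i, 0 < (A i).card)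
    {r : MvPolynomial (Fin (n + 1)) K} (hr : r ∈ vanishingIdeal (cartesianSet A))
    (hs : ∀ c ∈ r.support, ∀ i : Fin n, c i.castSucc < (A i).card) : r = 0 := by
  ext a
  rw [coeff_zero]
  -- Dehomogenization can merge terms of different degrees, so one homogeneous component is treated
  -- at a time.
  set q := homogeneousComponent a.degree r with hq
  have hqh : q.IsHomogeneous a.degree := homogeneousComponent_isHomogeneous _ _
  have hqs : ∀ c ∈ q.support, c ∈ r.support := fun c hc => by
    rw [mem_support_iff, hq, coeff_homogeneousComponent] at hc
    rw [mem_support_iff]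
    intro h0
    exact hc (by simp [h0])
  have h0 : dehom n K q = 0 := by
    refine eq_zero_of_eval_zero_at_prod_finset _ A (fun i => ?_) fun x hx => ?_
    · rw [degreeOf_eq_sup, Finset.sup_lt_iff (hA i)]
      intro b hb
      obtain ⟨c, hc, rfl⟩ := exists_of_mem_support_dehom hb
      exact hs c (hqs c hc) i
    · rw [eval_dehom]
      exact eval_snoc_eq_zero_of_mem (homogeneousComponent_mem_vanishingIdeal hr _) hx
  have h1 := coeff_dehom hqh
  rw [h0, coeff_zero, hq, coeff_homogeneousComponent, if_pos rfl] at h1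
  exact h1.symm

/-! ### The initial ideal -/

/-- The ideal generated by the monomials with exponents `δ i` in the `i`-th variable for `i < n`,
and with exponents in `M`. -/
def boxIdeal (K : Type*) [Field K] (δ : Fin n → ℕ) (M : Set (Fin (n + 1) →₀ ℕ)) :
    Ideal (MvPolynomial (Fin (n + 1)) K) :=
  Ideal.span ((fun a => monomial a (1 : K)) ''
    (Set.range (fun i : Fin n => Finsupp.single i.castSucc (δ i)) ∪ M))

lemma mem_boxIdeal {δ : Fin n → ℕ} {M : Set (Fin (n + 1) →₀ ℕ)}
    {f : MvPolynomial (Fin (n + 1)) K} :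
    f ∈ boxIdeal K δ M ↔
      ∀ c ∈ f.support, (∃ i : Fin n, δ i ≤ c i.castSucc) ∨ ∃ a ∈ M, a ≤ c := by
  rw [boxIdeal, mem_ideal_span_monomial_image]
  simp [or_and_right, exists_or, Finsupp.single_le_iff]

lemma monomial_mem_boxIdeal {δ : Fin n → ℕ} {M : Set (Fin (n + 1) →₀ ℕ)}
    {c : Fin (n + 1) →₀ ℕ} :
    monomial c (1 : K) ∈ boxIdeal K δ M ↔
      (∃ i : Fin n, δ i ≤ c i.castSucc) ∨ ∃ a ∈ M, a ≤ c := by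
  classical
  rw [mem_boxIdeal, support_monomial, if_neg one_ne_zero]
  simp

/-- The forms `boxPoly A i` are a Gröbner basis: division by them leaves a reduced remainder inside
the ideal, which must be zero. -/
theorem initialIdeal_vanishingIdeal (m : MonomialOrder (Fin (n + 1))) (A : Fin n → Finset K)
    (hA : ∀ i, 0 < (A i).card)
    (hm : ∀ i : Fin n, m.toSyn (Finsupp.single (Fin.last n) 1) <
      m.toSyn (Finsupp.single i.castSucc 1)) :
    initialIdeal m (vanishingIdeal (cartesianSet A)) = boxIdeal K (fun i => (A i).card) ∅ := by
  refine le_antisymm (Ideal.span_le.2 ?_) (Ideal.span_le.2 ?_)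
  · rintro _ ⟨f, hf, hf0, rfl⟩
    by_contra hcon
    rw [SetLike.mem_coe, monomial_mem_boxIdeal] at hcon
    push Not at hcon
    obtain ⟨g, r, hfg, hg, hr⟩ := m.div (b := boxPoly A)
      (fun i => by simp [(monic_boxPoly m A (hm i)).leadingCoeff_eq_one]) f
    have hrm : r ∈ vanishingIdeal (cartesianSet A) := by
      rw [← sub_eq_iff_eq_add'] at hfg
      rw [← hfg, Finsupp.linearCombination_apply]
      exact Ideal.sub_mem _ hf (Ideal.sum_mem _ fun i _ =>
        Ideal.mul_mem_left _ _ (boxPoly_mem A i))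
    have hr0 : r = 0 := eq_zero_of_mem_vanishingIdeal hA hrm fun c hc i => by
      have := hr c hc i
      rw [degree_boxPoly m A (hm i), Finsupp.single_le_iff] at this
      exact not_le.1 this
    rw [hr0, add_zero, Finsupp.linearCombination_apply, Finsupp.sum] at hfg
    apply m.coeff_degree_ne_zero_iff.2 hf0
    conv_lhs => enter [2]; rw [hfg]
    rw [coeff_sum]
    -- The leading exponent of `f` has all entries below the box bounds, so it cannot be the leading
    -- exponent of a multiple of `boxPoly A i`. Each summand thus has strictly smaller leading
    -- exponent and contributes nothing to this coefficient.
    refine Finset.sum_eq_zero fun i _ => ?_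
    rw [smul_eq_mul, mul_comm]
    by_cases hgi : g i = 0
    · simp [hgi]
    refine m.coeff_eq_zero_of_lt (lt_of_le_of_ne (hg i) fun he => ?_)
    have he' := m.toSyn.injective he
    rw [m.degree_mul (monic_boxPoly m A (hm i)).ne_zero hgi, degree_boxPoly m A (hm i)] at he'
    have h1 := hcon.1 i
    rw [← he'] at h1
    simp at h1
  · rintro _ ⟨_, ⟨i, rfl⟩ | h, rfl⟩
    · exact Ideal.subset_span ⟨boxPoly A i, boxPoly_mem A i, (monic_boxPoly m A (hm i)).ne_zero,
        by rw [degree_boxPoly m A (hm i)]⟩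
    · exact h.elim

/-! ### Degrees -/

lemma krullDim_vanishingIdeal (A : Fin n → Finset K) (hA : ∀ i, (A i).Nonempty) :
    krullDim (vanishingIdeal (cartesianSet A)) = 1 := by
  choose x hx using hA
  refine krullDim_eq_one _ (aeval (Fin.snoc (α := fun _ => Polynomial K)
    (fun i => Polynomial.C (x i) * Polynomial.X) Polynomial.X)) (by simp) ?_ fun i => ?_
  · intro f hf
    have : vanishingIdeal (cartesianSet A) ≤ RingHom.ker (aeval (R := K)
        (Fin.snoc (α := fun _ => Polynomial K)
          (fun i => Polynomial.C (x i) * Polynomial.X) Polynomial.X)) := by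
      refine Ideal.span_le.2 ?_
      rintro g ⟨⟨e, he⟩, hg⟩
      have h0 : eval (Fin.snoc (α := fun _ => K) x 1) g = 0 :=
        hg _ (snoc_one_ne_zero x) (boxEquiv A ⟨x, Fintype.mem_piFinset.2 hx⟩).2
      -- The substitution restricts to the line through the point `(x, 1)`; a form of degree `e`
      -- becomes `T ^ e` times its value at that point.
      have hsn : Fin.snoc (α := fun _ => Polynomial K)
          (fun i => Polynomial.C (x i) * Polynomial.X) Polynomial.X =
          fun j => Polynomial.X * Polynomial.C (Fin.snoc (α := fun _ => K) x 1 j) := by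
        ext1 j
        refine Fin.lastCases ?_ (fun i => ?_) j <;>
          simp only [Fin.snoc_castSucc, Fin.snoc_last, map_one] <;> ring
      rw [SetLike.mem_coe, RingHom.mem_ker, hsn, aeval_def, eval₂_eq]
      have hterm : ∀ c ∈ g.support, algebraMap K (Polynomial K) (coeff c g) *
          ∏ j ∈ c.support, (Polynomial.X *
            Polynomial.C (Fin.snoc (α := fun _ => K) x 1 j)) ^ c j =
          Polynomial.X ^ e * Polynomial.C (coeff c g *
            ∏ j ∈ c.support, (Fin.snoc (α := fun _ => K) x 1 j) ^ c j) := by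
        intro c hc
        have hd : ∑ i ∈ c.support, c i = e := degree_eq_of_mem_support he hc
        simp only [mul_pow, Finset.prod_mul_distrib, Finset.prod_pow_eq_pow_sum, hd,
          Polynomial.algebraMap_eq, map_mul, map_prod, map_pow]
        ring
      rw [Finset.sum_congr rfl hterm, ← Finset.mul_sum, ← map_sum, ← eval_eq, h0]
      simp
    exact this hf
  · exact ⟨(A i).val, boxPoly_mem A i⟩

/-- Lagrange interpolation: the indicator polynomials of grid points have degree at most `∑ (d_i -
1)`, so from there on evaluation is onto. -/
lemma hilbertFunction_vanishingIdeal (A : Fin n → Finset K) {e : ℕ}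
    (he : ∑ i, ((A i).card - 1) ≤ e) :
    hilbertFunction (vanishingIdeal (cartesianSet A)) e = ∏ i, (A i).card := by
  classical
  let φ : MvPolynomial (Fin (n + 1)) K →ₗ[K] Fintype.piFinset A → K :=
    LinearMap.pi fun x => (aeval (Fin.snoc (α := fun _ => K) x.1 1)).toLinearMap
  have hφ : ∀ f x, φ f x = eval (Fin.snoc (α := fun _ => K) x.1 1) f := fun f x => by
    simp [φ, aeval_eq_eval]
  rw [hilbertFunction_eq_card φ, Fintype.card_coe, Fintype.card_piFinset]
  · intro v
    let L : Fintype.piFinset A → MvPolynomial (Fin n) K := fun x =>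
      linProd fun i => (A i).erase (x.1 i)
    have hL : ∀ x y : Fintype.piFinset A, eval y.1 (L x) ≠ 0 ↔ y = x := fun x y => by
      rw [eval_linProd_ne_zero_iff, Subtype.ext_iff, funext_iff]
      refine forall_congr' fun i => ?_
      simp [Fintype.mem_piFinset.1 y.2 i]
    have hLd : ∀ x, (L x).totalDegree ≤ e := fun x =>
      (totalDegree_linProd_le _).trans <| le_trans (Finset.sum_le_sum fun i _ => by
        rw [Finset.card_erase_of_mem (Fintype.mem_piFinset.1 x.2 i)]) he
    refine ⟨∑ x, C (v x / eval x.1 (L x)) * homog e (L x),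
      IsHomogeneous.sum _ _ _ fun x _ => ?_, ?_⟩
    · exact (isHomogeneous_homog (hLd x)).C_mul _
    · ext y
      rw [hφ, map_sum, Finset.sum_eq_single y]
      · rw [map_mul, eval_C, eval_homog, div_mul_cancel₀ _ ((hL y y).2 rfl)]
      · intro x _ hxy
        have : eval y.1 (L x) = 0 := not_not.1 fun h => hxy ((hL x y).1 h).symm
        rw [map_mul, eval_homog, this, mul_zero]
      · simp
  · intro f hf
    constructor
    · intro h
      refine mem_vanishingIdeal hf fun x hx => ?_
      rw [← hφ f ⟨x, Fintype.mem_piFinset.2 hx⟩, h]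
      rfl
    · intro h
      ext x
      rw [hφ]
      exact eval_snoc_eq_zero_of_mem h (Fintype.mem_piFinset.1 x.2)

theorem degree_vanishingIdeal (A : Fin n → Finset K) (hA : ∀ i, (A i).Nonempty) :
    degree (vanishingIdeal (cartesianSet A)) = (∏ i, (A i).card : ℕ) :=
  degree_eq_of_hilbertFunction_eq (krullDim_vanishingIdeal A hA)
    fun _ he => hilbertFunction_vanishingIdeal A he

/-- Since no generator is a power of the last variable, all of them vanish when the other variables
are set to `0`. -/
lemma krullDim_boxIdeal {δ : Fin n → ℕ} (hδ : ∀ i, 0 < δ i) {M : Set (Fin (n + 1) →₀ ℕ)}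
    (hM : ∀ a ∈ M, ∃ i : Fin n, a i.castSucc ≠ 0) :
    krullDim (boxIdeal K δ M) = 1 := by
  refine krullDim_eq_one _ (aeval (Fin.snoc (α := fun _ => Polynomial K) 0 Polynomial.X))
    (by simp) ?_ fun i => ⟨Multiset.replicate (δ i) 0, ?_⟩
  · intro f hf
    have hz : ∀ c : Fin (n + 1) →₀ ℕ, (∃ i : Fin n, c i.castSucc ≠ 0) →
        aeval (Fin.snoc (α := fun _ => Polynomial K) 0 Polynomial.X) (monomial c (1 : K)) = 0 := by
      rintro c ⟨i, hi⟩
      rw [aeval_monomial, Finsupp.prod_fintype _ _ (by simp), Fin.prod_univ_castSucc,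
        Finset.prod_eq_zero (Finset.mem_univ i)]
      · simp
      · simp [hi]
    have : boxIdeal K δ M ≤ RingHom.ker (aeval (R := K)
        (Fin.snoc (α := fun _ => Polynomial K) 0 Polynomial.X)) := by
      refine Ideal.span_le.2 ?_
      rintro _ ⟨_, ⟨i, rfl⟩ | h, rfl⟩
      · exact hz _ ⟨i, by simpa using (hδ i).ne'⟩
      · exact hz _ (hM _ h)
    exact this hf
  · have : (monomial (Finsupp.single i.castSucc (δ i)) (1 : K)) ∈ boxIdeal K δ M :=
      Ideal.subset_span ⟨_, Or.inl ⟨i, rfl⟩, rfl⟩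
    simpa [X_pow_eq_monomial] using this

lemma hilbertFunction_boxIdeal (δ : Fin n → ℕ) {a b : Fin (n + 1) →₀ ℕ} {d e : ℕ}
    (ha : a.degree = d) (hb : b.degree = d) (he : ∑ i, δ i + d ≤ e) :
    hilbertFunction (boxIdeal K δ {a, b}) e + upperCount δ (truncExp a) (truncExp b) =
      ∏ i, δ i := by
  classical
  set T := (expBox δ).filter fun c => ¬ (⇑(truncExp a) ≤ c ∨ ⇑(truncExp b) ≤ c) with hT
  let ι : (Fin n → ℕ) → (Fin n →₀ ℕ) := Finsupp.equivFunOnFinite.symm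
  let φ : MvPolynomial (Fin (n + 1)) K →ₗ[K] T → K :=
    LinearMap.pi fun c => lcoeff K (homogExp e (ι c))
  have hφ : ∀ f c, φ f c = coeff (homogExp e (ι c)) f := fun f c => rfl
  have hdeg : ∀ c ∈ expBox δ, (ι c).degree + d ≤ e := fun c hc => by
    refine le_trans (Nat.add_le_add_right ?_ d) he
    rw [Finsupp.degree_eq_sum]
    exact Finset.sum_le_sum fun i _ => (mem_expBox.1 hc i).le
  have hcard : hilbertFunction (boxIdeal K δ {a, b}) e = T.card := by
    rw [hilbertFunction_eq_card φ, Fintype.card_coe]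
    · intro v
      refine ⟨∑ c : T, monomial (homogExp e (ι c)) (v c),
        IsHomogeneous.sum _ _ _ fun c _ => isHomogeneous_monomial _ (degree_homogExp
          ((Nat.le_add_right _ _).trans (hdeg c (Finset.mem_filter.1 c.2).1))), ?_⟩
      ext c
      rw [hφ, coeff_sum, Finset.sum_eq_single c]
      · simp
      · intro c' _ hc
        rw [coeff_monomial, if_neg]
        intro h
        apply hc
        have := congrArg truncExp h
        simp only [truncExp_homogExp] at this
        exact Subtype.ext (Finsupp.equivFunOnFinite.symm.injective this)
      · simp
    · intro f hf
      rw [mem_boxIdeal]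
      constructor
      · intro h c hc
        have hce : c.degree = e := degree_eq_of_mem_support hf hc
        by_contra! hcon
        obtain ⟨h1, h2⟩ := hcon
        have hbox : ⇑(truncExp c) ∈ expBox δ := mem_expBox.2 h1
        -- The bound on `e` leaves a last exponent of at least `d`. Divisibility by a monomial of
        -- degree `d` is then decided by the first `n` exponents alone.
        have hlast : d ≤ c (Fin.last n) := by
          have := hdeg _ hbox
          have h3 := degree_eq_truncExp_add c
          have h4 : ι (truncExp c) = truncExp c := by ext; rfl
          rw [h4] at this
          omega
        have hle : ∀ u : Fin (n + 1) →₀ ℕ, u.degree = d → ⇑(truncExp u) ≤ truncExp c → u ≤ c := by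
          intro u hu huc j
          refine Fin.lastCases ?_ (fun i => ?_) j
          · have := degree_eq_truncExp_add u
            omega
          · exact huc i
        have hcT : ⇑(truncExp c) ∈ T := Finset.mem_filter.2 ⟨hbox, by
          rintro (h5 | h5)
          · exact h2 a (by simp) (hle a ha h5)
          · exact h2 b (by simp) (hle b hb h5)⟩
        have := congrFun h ⟨_, hcT⟩
        rw [hφ] at this
        apply mem_support_iff.1 hc
        rw [← homogExp_truncExp c, hce]
        have h4 : ι (truncExp c) = truncExp c := by ext; rfl
        simpa [h4] using this
      · intro h
        ext c
        rw [hφ]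
        by_contra hne
        have hcT := Finset.mem_filter.1 c.2
        have hle : ∀ u : Fin (n + 1) →₀ ℕ, u ≤ homogExp e (ι c) → ⇑(truncExp u) ≤ c.1 := by
          intro u hu i
          simpa [ι] using hu i.castSucc
        rcases h _ (mem_support_iff.2 hne) with ⟨i, hi⟩ | ⟨u, rfl | rfl, hu⟩
        · rw [homogExp_castSucc] at hi
          exact absurd (mem_expBox.1 hcT.1 i) (not_lt.2 hi)
        · exact hcT.2 (Or.inl (hle _ hu))
        · exact hcT.2 (Or.inr (hle _ hu))
  rw [hcard, upperCount, add_comm, hT, Finset.card_filter_add_card_filter_not, expBox,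
    Fintype.card_piFinset]
  simp

theorem degree_boxIdeal {δ : Fin n → ℕ} (hδ : ∀ i, 0 < δ i) {a b : Fin (n + 1) →₀ ℕ}
    {d : ℕ} (ha : a.degree = d) (hb : b.degree = d) (ha' : ∃ i : Fin n, a i.castSucc ≠ 0)
    (hb' : ∃ i : Fin n, b i.castSucc ≠ 0) :
    degree (boxIdeal K δ {a, b}) =
      ((∏ i, δ i : ℕ) : ℝ) - upperCount δ (truncExp a) (truncExp b) := by
  have hle : upperCount δ (truncExp a) (truncExp b) ≤ ∏ i, δ i := by
    rw [← hilbertFunction_boxIdeal (K := K) δ ha hb le_rfl]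
    exact Nat.le_add_left _ _
  rw [degree_eq_of_hilbertFunction_eq (krullDim_boxIdeal hδ ?_) (N := ∑ i, δ i + d)
    (D := ∏ i, δ i - upperCount δ (truncExp a) (truncExp b)) ?_, Nat.cast_sub hle]
  · rintro _ (rfl | rfl) <;> assumption
  · intro e he
    have := hilbertFunction_boxIdeal (K := K) δ ha hb he
    omega

end

/-! ### Admissible pairs -/

section

variable {n : ℕ}

open Classical in
lemma card_filter_le {δ : Fin n → ℕ} (a : Fin n → ℕ) :
    ((expBox δ).filter fun c => a ≤ c).card = ∏ i, (δ i - a i) := by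
  have : ((expBox δ).filter fun c => a ≤ c) =
      Fintype.piFinset fun i => Finset.Ico (a i) (δ i) := by
    ext c
    simp only [Finset.mem_filter, mem_expBox, Fintype.mem_piFinset, Finset.mem_Ico, Pi.le_def,
      ← forall_and]
    exact forall_congr' fun i => and_comm
  rw [this, Fintype.card_piFinset]
  simp

/-- Inclusion-exclusion: lying above both `a` and `b` means lying above `a ⊔ b`. Box membership
keeps the truncated differences equal to the integer ones. -/
lemma upperCount_eq_prod {δ : Fin n → ℕ} {a b : Fin n → ℕ} (ha : a ∈ expBox δ)
    (hb : b ∈ expBox δ) :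
    (upperCount δ a b : ℤ) = ∏ i, ((δ i : ℤ) - a i) + ∏ i, ((δ i : ℤ) - b i)
      - ∏ i, min ((δ i : ℤ) - a i) ((δ i : ℤ) - b i) := by
  classical
  have h1 : upperCount δ a b + ((expBox δ).filter fun c => a ⊔ b ≤ c).card =
      ((expBox δ).filter fun c => a ≤ c).card + ((expBox δ).filter fun c => b ≤ c).card := by
    rw [← Finset.card_union_add_card_inter, ← Finset.filter_or, ← Finset.filter_and, upperCount]
    simp only [sup_le_iff]
  rw [card_filter_le, card_filter_le, card_filter_le] at h1
  have hcast : ∀ c : Fin n → ℕ, c ∈ expBox δ →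
      ((∏ i, (δ i - c i) : ℕ) : ℤ) = ∏ i, ((δ i : ℤ) - c i) := fun c hc => by
    rw [Nat.cast_prod]
    exact Finset.prod_congr rfl fun i _ => Nat.cast_sub (mem_expBox.1 hc i).le
  have hsup : a ⊔ b ∈ expBox δ := mem_expBox.2 fun i =>
    max_lt (mem_expBox.1 ha i) (mem_expBox.1 hb i)
  have h2 := congrArg (Nat.cast : ℕ → ℤ) h1
  rw [Nat.cast_add, Nat.cast_add, hcast a ha, hcast b hb, hcast _ hsup] at h2
  have h3 : ∏ i, ((δ i : ℤ) - ((a ⊔ b) i : ℕ)) =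
      ∏ i, min ((δ i : ℤ) - a i) ((δ i : ℤ) - b i) :=
    Finset.prod_congr rfl fun i _ => by
      rw [Pi.sup_apply, Nat.cast_max]
      exact (min_sub_sub_left _ _ _).symm
  rw [← h3, ← h2]
  ring

lemma upperCount_le_prod (δ : Fin n → ℕ) (a b : Fin n → ℕ) : upperCount δ a b ≤ ∏ i, δ i := by
  classical
  refine (Finset.card_filter_le _ _).trans_eq ?_
  simp [expBox]

lemma upperCount_eq_of_eq_zero (δ : Fin n → ℕ) {a b : Fin n → ℕ} (h : a = 0 ∨ b = 0) :
    upperCount δ a b = ∏ i, δ i := by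
  classical
  rw [upperCount, Finset.filter_true_of_mem]
  · simp [expBox]
  · rcases h with rfl | rfl
    · exact fun c _ => Or.inl fun i => Nat.zero_le _
    · exact fun c _ => Or.inr fun i => Nat.zero_le _

lemma boxPairs_of_admissible {δ : Fin n → ℕ} (hδ : ∀ i, 0 < δ i) {d : ℕ}
    {a b : Fin (n + 1) → ℕ} (h : (a, b) ∈ admissiblePairs δ d) :
    ((fun i => a i.castSucc), (fun i => b i.castSucc)) ∈ boxPairs δ d := by
  obtain ⟨hab, ha, hb, hle, -, -⟩ := h
  simp only at hab ha hb hle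
  rw [Fin.sum_univ_castSucc] at ha hb
  refine ⟨fun he => hab ?_, mem_expBox.2 fun i => ?_, mem_expBox.2 fun i => ?_, ?_, ?_⟩
  · simp only at he
    funext j
    refine Fin.lastCases ?_ (fun i => congrFun he i) j
    have : ∑ i : Fin n, a i.castSucc = ∑ i : Fin n, b i.castSucc :=
      Finset.sum_congr rfl fun i _ => congrFun he i
    omega
  · have := (hle i).1
    have := hδ i
    simp only
    omega
  · have := (hle i).2
    have := hδ i
    simp only
    omega
  · simp only
    omega
  · simp only
    omega

lemma exists_admissible_of_boxPairs {δ : Fin n → ℕ} {d : ℕ} {a b : Fin n → ℕ}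
    (h : (a, b) ∈ boxPairs δ d) (ha0 : a ≠ 0) (hb0 : b ≠ 0) :
    ∃ p ∈ admissiblePairs δ d, (fun i : Fin n => p.1 i.castSucc) = a ∧
      (fun i : Fin n => p.2 i.castSucc) = b := by
  obtain ⟨hab, ha, hb, had, hbd⟩ := h
  simp only at hab ha hb had hbd
  refine ⟨(Fin.snoc (α := fun _ => ℕ) a (d - ∑ i, a i), Fin.snoc (α := fun _ => ℕ) b (d - ∑ i, b i)),
    ⟨fun he => hab ?_, ?_, ?_, fun i => ?_, ?_, ?_⟩, by ext; simp, by ext; simp⟩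
  · funext i
    simpa using congrFun he i.castSucc
  · simp only [Fin.sum_univ_castSucc, Fin.snoc_castSucc, Fin.snoc_last]
    omega
  · simp only [Fin.sum_univ_castSucc, Fin.snoc_castSucc, Fin.snoc_last]
    omega
  · simp only [Fin.snoc_castSucc]
    exact ⟨Nat.le_sub_one_of_lt (mem_expBox.1 ha i), Nat.le_sub_one_of_lt (mem_expBox.1 hb i)⟩
  · simpa using Function.ne_iff.1 ha0
  · simpa using Function.ne_iff.1 hb0

lemma boxPairs_nonempty {δ : Fin n → ℕ} (hδ : ∀ i, 2 ≤ δ i) {d : ℕ} (hd : 1 ≤ d) (i : Fin n) :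
    (boxPairs δ d).Nonempty := by
  refine ⟨(0, Pi.single i 1), fun h => ?_, mem_expBox.2 fun j => ?_, mem_expBox.2 fun j => ?_,
    by simp, by simpa using hd⟩
  · have := congrFun h i
    simp at this
  · have := hδ j
    simp only [Pi.zero_apply]
    omega
  · have := hδ j
    simp only [Pi.single_apply]
    split_ifs <;> omega

lemma admissiblePairs_nonempty {δ : Fin n → ℕ} (hδ : ∀ i, 2 ≤ δ i) {d : ℕ} (hd : 1 ≤ d)
    (hd' : d ≤ ∑ i, (δ i - 1)) (hnd : ¬ (n = 1 ∧ d = 1)) : (admissiblePairs δ d).Nonempty := by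
  have key : ∀ a b : Fin n → ℕ, (a, b) ∈ boxPairs δ d → a ≠ 0 → b ≠ 0 →
      (admissiblePairs δ d).Nonempty := fun a b h ha hb => by
    obtain ⟨p, hp, -⟩ := exists_admissible_of_boxPairs h ha hb
    exact ⟨p, hp⟩
  have hsingle : ∀ (i : Fin n) (k : ℕ), k < δ i → Pi.single i k ∈ expBox δ := fun i k hk =>
    mem_expBox.2 fun j => by
      by_cases hji : j = i
      · subst hji; simpa using hk
      · have := hδ j
        simp only [Pi.single_eq_of_ne hji]
        omega
  rcases Nat.lt_or_ge n 2 with hn | hn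
  · interval_cases n
    · simp at hd'
      omega
    · have h0 : d ≤ δ 0 - 1 := by simpa using hd'
      -- For `n = 1` the excluded case forces `d ≥ 2`, and `d ≤ δ 0 - 1` puts the exponent `2`
      -- inside the box.
      refine key (Pi.single 0 1) (Pi.single 0 2) ⟨fun h => ?_, hsingle _ _ (hδ 0),
        hsingle _ _ (by omega), by simpa using hd, by simp; omega⟩ (by simp) (by simp)
      simpa using congrFun h 0
  · let i : Fin n := ⟨0, by omega⟩
    let j : Fin n := ⟨1, by omega⟩
    have hij : i ≠ j := by simp [i, j]
    refine key (Pi.single i 1) (Pi.single j 1) ⟨fun h => ?_, hsingle _ _ (hδ i),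
      hsingle _ _ (hδ j), by simpa using hd, by simpa using hd⟩ (by simp) (by simp)
    have := congrFun h i
    simp [hij] at this

end

/-! ### The footprint function -/

section

variable {n : ℕ} {K : Type*} [Field K]

/-- Two standard monomials annihilate a nonzero element modulo the box ideal iff neither of them
is a power of the last variable. -/
lemma colon_boxIdeal_ne_iff {δ : Fin n → ℕ} (hδ : ∀ i, 0 < δ i)
    {a b : Fin (n + 1) →₀ ℕ} :
    (boxIdeal K δ ∅).colon (monomials K {a, b}) ≠ boxIdeal K δ ∅ ↔
      (∃ i : Fin n, a i.castSucc ≠ 0) ∧ ∃ i : Fin n, b i.castSucc ≠ 0 := by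
  classical
  constructor
  · intro h
    by_contra hcon
    apply h
    -- A power of the last variable is a nonzerodivisor modulo the box ideal, so its presence makes
    -- the colon trivial.
    have key : ∀ u : Fin (n + 1) →₀ ℕ, u ∈ ({a, b} : Finset (Fin (n + 1) →₀ ℕ)) →
        (¬ ∃ i : Fin n, u i.castSucc ≠ 0) →
        (boxIdeal K δ ∅).colon (monomials K {a, b}) = boxIdeal K δ ∅ := by
      intro u hu hu0
      push Not at hu0
      refine le_antisymm (fun f hf => ?_) fun f hf => ?_
      · have hfu : f * monomial u 1 ∈ boxIdeal K δ ∅ :=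
          Submodule.mem_colon.1 hf _ ⟨u, hu, rfl⟩
        rw [mem_boxIdeal] at hfu ⊢
        intro c hc
        have := hfu (c + u) (by
          rw [mem_support_iff, coeff_mul_monomial, mul_one]
          exact mem_support_iff.1 hc)
        simpa [hu0] using this
      · exact Submodule.mem_colon.2 fun g _ => by
          rw [smul_eq_mul]
          exact Ideal.mul_mem_right _ _ hf
    rw [not_and_or] at hcon
    rcases hcon with h0 | h0
    · exact key a (by simp) h0
    · exact key b (by simp) h0
  · rintro ⟨⟨i, hi⟩, ⟨j, hj⟩⟩ h
    -- The monomial `∏ t_i^{d_i - 1}` is standard, yet any further factor `t_k` with `k ≤ n` sends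
    -- it into the ideal. Truncated subtraction in `homogExp 0` makes its last exponent `0`.
    have hsoc : monomial (homogExp 0 (Finsupp.equivFunOnFinite.symm fun i => δ i - 1)) (1 : K) ∈
        (boxIdeal K δ ∅).colon (monomials K {a, b}) := by
      refine Submodule.mem_colon.2 ?_
      rintro _ ⟨u, hu, rfl⟩
      obtain ⟨k, hk⟩ : ∃ k : Fin n, u k.castSucc ≠ 0 := by
        simp only [Finset.coe_insert, Finset.coe_singleton, Set.mem_insert_iff,
          Set.mem_singleton_iff] at hu
        rcases hu with rfl | rfl
        exacts [⟨i, hi⟩, ⟨j, hj⟩]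
      rw [smul_eq_mul, monomial_mul, one_mul, monomial_mem_boxIdeal]
      refine Or.inl ⟨k, ?_⟩
      simp only [Finsupp.add_apply, homogExp_castSucc, Finsupp.equivFunOnFinite_symm_apply_apply]
      omega
    rw [h, monomial_mem_boxIdeal] at hsoc
    obtain ⟨k, hk⟩ | ⟨_, hu, _⟩ := hsoc
    · have := hδ k
      simp only [homogExp_castSucc, Finsupp.equivFunOnFinite_symm_apply_apply] at hk
      omega
    · exact hu.elim

lemma boxIdeal_sup_span_monomials (δ : Fin n → ℕ) (M : Finset (Fin (n + 1) →₀ ℕ)) :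
    boxIdeal K δ ∅ ⊔ Ideal.span (monomials K M) = boxIdeal K δ (M : Set (Fin (n + 1) →₀ ℕ)) := by
  rw [boxIdeal, boxIdeal, monomials, ← Ideal.span_union, ← Set.image_union, Set.union_empty]

lemma mem_footprintSets_iff (m : MonomialOrder (Fin (n + 1)))
    {I : Ideal (MvPolynomial (Fin (n + 1)) K)} {δ : Fin n → ℕ} (hδ : ∀ i, 0 < δ i)
    (hI : initialIdeal m I = boxIdeal K δ ∅) {d : ℕ} {M : Finset (Fin (n + 1) →₀ ℕ)} :
    M ∈ footprintSets m I d 2 ↔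
      ∃ a b : Fin (n + 1) →₀ ℕ, M = {a, b} ∧ (⇑a, ⇑b) ∈ admissiblePairs δ d := by
  classical
  have hfoot : ∀ a : Fin (n + 1) →₀ ℕ, (a ∈ footprint m I ∧ a.degree = d) ↔
      (∑ j, a j = d ∧ ∀ i : Fin n, a i.castSucc ≤ δ i - 1) := fun a => by
    rw [footprint, Set.mem_ofPred_eq, hI, monomial_mem_boxIdeal, Finsupp.degree_eq_sum, and_comm]
    simp only [Set.mem_empty_iff_false, false_and, exists_false, or_false, not_exists, not_le]
    exact and_congr_right' (forall_congr' fun i => by have := hδ i; omega)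
  constructor
  · rintro ⟨hcard, hM, hcol⟩
    obtain ⟨a, b, hab, rfl⟩ := Finset.card_eq_two.1 hcard
    rw [hI, colon_boxIdeal_ne_iff hδ] at hcol
    have ha := (hfoot a).1 (hM a (by simp))
    have hb := (hfoot b).1 (hM b (by simp))
    exact ⟨a, b, rfl, fun h => hab (DFunLike.coe_injective h), ha.1, hb.1,
      fun i => ⟨ha.2 i, hb.2 i⟩, hcol.1, hcol.2⟩
  · rintro ⟨a, b, rfl, hab, ha, hb, hle, ha0, hb0⟩
    refine ⟨Finset.card_pair fun h => hab (congrArg DFunLike.coe h), fun u hu => ?_, ?_⟩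
    · rw [hfoot]
      rcases Finset.mem_insert.1 hu with rfl | hu
      · exact ⟨ha, fun i => (hle i).1⟩
      · rw [Finset.mem_singleton.1 hu]
        exact ⟨hb, fun i => (hle i).2⟩
    · rw [hI, colon_boxIdeal_ne_iff hδ]
      exact ⟨ha0, hb0⟩

/-- The footprint function equals any least value of `upperCount` on admissible pairs. -/
lemma fp_eq_of_isLeast (m : MonomialOrder (Fin (n + 1))) (A : Fin n → Finset K)
    (hA : ∀ i, 0 < (A i).card)
    (hm : ∀ i : Fin n, m.toSyn (Finsupp.single (Fin.last n) 1) <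
      m.toSyn (Finsupp.single i.castSucc 1)) {d w : ℕ}
    (hw : IsLeast ((fun p : (Fin (n + 1) → ℕ) × (Fin (n + 1) → ℕ) =>
      upperCount (fun i => (A i).card) (fun i => p.1 i.castSucc) fun i => p.2 i.castSucc) ''
      admissiblePairs (fun i => (A i).card) d) w) :
    fp m (vanishingIdeal (cartesianSet A)) d 2 = w := by
  classical
  have hI := initialIdeal_vanishingIdeal m A hA hm
  have hdeg : ∀ a b : Fin (n + 1) →₀ ℕ, (⇑a, ⇑b) ∈ admissiblePairs (fun i => (A i).card) d →
      degree (initialIdeal m (vanishingIdeal (cartesianSet A)) ⊔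
        Ideal.span (monomials K ({a, b} : Finset _))) =
      ((∏ i, (A i).card : ℕ) : ℝ) -
        upperCount (fun i => (A i).card) (truncExp a) (truncExp b) := by
    rintro a b ⟨-, ha, hb, -, ha0, hb0⟩
    rw [hI, boxIdeal_sup_span_monomials, Finset.coe_pair]
    exact degree_boxIdeal hA (d := d) (by rw [Finsupp.degree_eq_sum]; exact ha)
      (by rw [Finsupp.degree_eq_sum]; exact hb) ha0 hb0
  have hgreat : IsGreatest ((fun M => degree (initialIdeal m (vanishingIdeal (cartesianSet A)) ⊔
      Ideal.span (monomials K M))) '' footprintSets m (vanishingIdeal (cartesianSet A)) d 2)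
      (((∏ i, (A i).card : ℕ) : ℝ) - w) := by
    constructor
    · obtain ⟨⟨a, b⟩, hp, hpw⟩ := hw.1
      let a' : Fin (n + 1) →₀ ℕ := Finsupp.equivFunOnFinite.symm a
      let b' : Fin (n + 1) →₀ ℕ := Finsupp.equivFunOnFinite.symm b
      refine ⟨{a', b'}, (mem_footprintSets_iff m hA hI).2 ⟨a', b', rfl, hp⟩, ?_⟩
      simp only
      rw [hdeg a' b' hp, ← hpw]
      rfl
    · rintro _ ⟨M, hM, rfl⟩
      obtain ⟨a, b, rfl, hp⟩ := (mem_footprintSets_iff m hA hI).1 hM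
      simp only
      rw [hdeg a b hp]
      refine sub_le_sub_left (Nat.cast_le.2 ?_) _
      exact hw.2 ⟨_, hp, rfl⟩
  rw [fp, if_pos hgreat.nonempty.of_image, hgreat.csSup_eq,
    degree_vanishingIdeal A fun i => Finset.card_pos.1 (hA i)]
  ring

lemma fp_eq_of_admissiblePairs_eq_empty (m : MonomialOrder (Fin (n + 1))) (A : Fin n → Finset K)
    (hA : ∀ i, 0 < (A i).card)
    (hm : ∀ i : Fin n, m.toSyn (Finsupp.single (Fin.last n) 1) <
      m.toSyn (Finsupp.single i.castSucc 1)) {d : ℕ}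
    (h : admissiblePairs (fun i => (A i).card) d = ∅) :
    fp m (vanishingIdeal (cartesianSet A)) d 2 = (∏ i, (A i).card : ℕ) := by
  rw [fp, if_neg, degree_vanishingIdeal A fun i => Finset.card_pos.1 (hA i)]
  rintro ⟨M, hM⟩
  obtain ⟨a, b, -, hp⟩ :=
    (mem_footprintSets_iff m hA (initialIdeal_vanishingIdeal m A hA hm)).1 hM
  simp [h] at hp

/-- On nonempty sets of admissible pairs the generalized Hamming weight is attained. -/
lemma isLeast_admissiblePairs (A : Fin n → Finset K) (hA : ∀ i, 0 < (A i).card) {d : ℕ}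
    (hne : (admissiblePairs (fun i => (A i).card) d).Nonempty) :
    IsLeast ((fun p : (Fin (n + 1) → ℕ) × (Fin (n + 1) → ℕ) =>
      upperCount (fun i => (A i).card) (fun i => p.1 i.castSucc) fun i => p.2 i.castSucc) ''
      admissiblePairs (fun i => (A i).card) d)
      (generalizedHammingWeight (code (cartesianSet A) d) 2) := by
  obtain ⟨⟨a, b⟩, hp⟩ := hne
  have hw := isLeast_generalizedHammingWeight A ⟨_, boxPairs_of_admissible hA hp⟩
  have hlow : ∀ p ∈ admissiblePairs (fun i => (A i).card) d,
      generalizedHammingWeight (code (cartesianSet A) d) 2 ≤ upperCount (fun i => (A i).card)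
        (fun i => p.1 i.castSucc) fun i => p.2 i.castSucc :=
    fun p hp => hw.2 ⟨_, boxPairs_of_admissible (a := p.1) (b := p.2) hA hp, rfl⟩
  refine ⟨?_, fun _ ⟨p, hp, h⟩ => h ▸ hlow p hp⟩
  obtain ⟨⟨a', b'⟩, hq, hqw⟩ := hw.1
  simp only at hqw
  -- If the minimum is attained at a pair containing `0`, it equals the maximal count `∏ d_i`, so
  -- the given admissible pair attains it as well.
  by_cases h0 : a' = 0 ∨ b' = 0
  · refine ⟨_, hp, le_antisymm ?_ (hlow _ hp)⟩
    rw [← hqw, upperCount_eq_of_eq_zero _ h0]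
    exact upperCount_le_prod _ _ _
  · rw [not_or] at h0
    obtain ⟨p, hp', rfl, rfl⟩ := exists_admissible_of_boxPairs hq h0.1 h0.2
    exact ⟨p, hp', hqw⟩

end
end RMType

end

theorem mainTheorem4 {K : Type*} [Field K] [Finite K] (n : ℕ) (A : Fin n → Finset K)
    (hA : ∀ i, 2 ≤ (A i).card) (hmono : Monotone fun i => (A i).card)
    (m : MonomialOrder (Fin (n + 1)))
    (hm : ∀ i : Fin n, m.toSyn (Finsupp.single (Fin.last n) 1) <
      m.toSyn (Finsupp.single i.castSucc 1))
    (d : ℕ) (hd : 1 ≤ d) (hd' : d ≤ ∑ i, ((A i).card - 1)) :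
    RMType.fp m (RMType.vanishingIdeal (RMType.cartesianSet A)) d 2 =
        (RMType.generalizedHammingWeight (RMType.code (RMType.cartesianSet A) d) 2 : ℝ) ∧
      (¬ (n = 1 ∧ d = 1) →
        IsLeast
          {v : ℤ | ∃ p ∈ RMType.admissiblePairs (fun i => (A i).card) d,
            v = RMType.pairValue (fun i => (A i).card) p.1 p.2}
          (RMType.generalizedHammingWeight (RMType.code (RMType.cartesianSet A) d) 2 : ℤ)) := by
  have hpos : ∀ i, 0 < (A i).card := fun i => lt_of_lt_of_le two_pos (hA i)
  refine ⟨?_, fun hnd => ?_⟩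
  · rcases (RMType.admissiblePairs (fun i => (A i).card) d).eq_empty_or_nonempty with he | hne
    · rw [RMType.fp_eq_of_admissiblePairs_eq_empty m A hpos hm he]
      have hn : 0 < n := by
        rcases Nat.eq_zero_or_pos n with rfl | h
        · simp at hd'
          omega
        · exact h
      obtain ⟨⟨a, b⟩, hq, hqw⟩ := (RMType.isLeast_generalizedHammingWeight A
        (RMType.boxPairs_nonempty hA hd ⟨0, hn⟩)).1
      rw [← hqw]
      -- Without admissible pairs, every box pair contains `0`; the weight is then `∏ d_i`, matching
      -- the default branch of `fp`.
      by_cases h0 : a = 0 ∨ b = 0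
      · simp only [RMType.upperCount_eq_of_eq_zero _ h0]
      · rw [not_or] at h0
        obtain ⟨p, hp, -⟩ := RMType.exists_admissible_of_boxPairs hq h0.1 h0.2
        simp [he] at hp
    · exact RMType.fp_eq_of_isLeast m A hpos hm (RMType.isLeast_admissiblePairs A hpos hne)
  · have hval : ∀ p ∈ RMType.admissiblePairs (fun i => (A i).card) d,
        RMType.pairValue (fun i => (A i).card) p.1 p.2 =
          (RMType.upperCount (fun i => (A i).card) (fun i => p.1 i.castSucc)
            fun i => p.2 i.castSucc : ℤ) := fun p hp => by
      have hq := RMType.boxPairs_of_admissible (a := p.1) (b := p.2) hpos hp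
      rw [RMType.upperCount_eq_prod hq.2.1 hq.2.2.1, RMType.pairValue]
    have hw := RMType.isLeast_admissiblePairs A hpos
      (RMType.admissiblePairs_nonempty hA hd hd' hnd)
    constructor
    · obtain ⟨p, hp, hpw⟩ := hw.1
      exact ⟨p, hp, by rw [hval p hp, ← hpw]⟩
    · rintro _ ⟨p, hp, rfl⟩
      rw [hval p hp]
      exact Nat.cast_le.2 (hw.2 ⟨p, hp, rfl⟩)
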